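/- Let $\Sigma$ be a complete simplicial (rational) fan of dimension $d$ in $N_{\mathbb R}$ with toric variety $X_\Sigma$. For a cone $\omega$ write $V(\omega)$ for its torus orbit closure, $D_\rho=V(\rho)$ for the divisor of a ray $\rho$ and $u_\rho$ for the primitive generator of $\rho$; all cycle and divisor classes are taken in Chow groups with real coefficients. A wall is a cone of dimension $d-1$. A wall $\tau$ is called extremal if $\mathbb R_{\ge 0}[V(\tau)]$ is an extremal ray of the Mori cone of $X_\Sigma$. Let $\tau=\sigma\cap\sigma'$ be a wall with $\sigma,\sigma'$ the two maximal cones containing it, let $\gamma,\gamma'$ be the rays of $\sigma,\sigma'$ not in $\tau$, and let $\alpha$ be a ray of $\tau$ with $D_\alpha\cdot V(\tau)=0$. Write $\tau\setminus\alpha$, $\sigma\setminus\alpha$, $\sigma'\setminus\alpha$ for the faces obtained by removing the ray $\alpha$. Let $\alpha^*$ be the dual of $u_\alpha$ with respect to the basis given by the ray generators of $\sigma$ or of $\sigma'$. 1. If $\eta\supseteq\tau\setminus\alpha$ is a wall, then $\alpha^*$ is everywhere positive, everywhere negative, or everywhere zero on the relative interior of $\eta$. 2. There is a wall $\eta\supseteq\tau\setminus\alpha$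 other than $\tau$, $\sigma\setminus\alpha$, $\sigma'\setminus\alpha$. For every such $\eta$, the relative interior of $\eta$ is contained in $\{z:\langle\alpha^*,z\rangle<0\}$. If moreover $\tau$ is extremal, then $[V(\eta)]\in\mathbb R_{\ge 0}[V(\tau)]$. 3. Suppose moreover that $\tau$ is extremal and that the cones of $\Sigma$ form a flag simplicial complex, and let $\eta$ be as in 2. Then $\eta$ spans a maximal cone of $\Sigma$ with $\gamma$ and another one with $\gamma'$, and $\eta$ is the only wall containing $\tau\setminus\alpha$ whose relative interior lies in $\{\langle\alpha^*,z\rangle<0\}$. Let $\beta$ be the ray of $\eta$ not in $\tau\setminus\alpha$. The link of $\tau\setminus\alpha$ is the 4-gon with vertices $\alpha,\gamma,\beta,\gamma'$ in this cyclic order. Writing $\overline D_\rho$ for the class of the restriction $D_\rho|_{V(\tau\setminus\alpha)}$ on the surface $V(\tau\setminus\alpha)$, we have: - $\overline D_\beta\in\mathbb R_{\ge 0}[V(\tau)]$; - $\overline D_\alpha\in\mathbb R_{\ge 0}[V(\tau)]$, and $\overline D_\alpha$ is not a scalar multiple of $\overline D_\gamma$ or of $\overline D_{\gamma'}$; - $\overline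 D_{\gamma'}\in\operatorname{Span}(\overline D_\alpha,\overline D_\gamma)$, and in $\overline D_{\gamma'}=a\overline D_\alpha+b\overline D_\gamma$ the coefficient $b$ is positive (equivalently, $\overline D_\gamma$ has negative coefficient $-b$ in the linear relation $\overline D_{\gamma'}-a\overline D_\alpha-b\overline D_\gamma=0$). -/

import Mathlib

open scoped Classical

noncomputable section

namespace ToricFan

variable {V : Type*} [NormedAddCommGroup V] [NormedSpace ℝ V]

/-- `u` is a primitive vector of the lattice `N`: a nonzero lattice vector that is not a proper
integer multiple of another lattice vector. -/
def IsPrimitive (N : Submodule ℤ V) (u : V) : Prop :=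
  u ∈ N ∧ ∀ (k : ℤ) (w : V), w ∈ N → u = k • w → IsUnit k

/-- A simplicial fan in `N_ℝ = V`, for a lattice `N` in `V`. A ray is recorded by its primitive
lattice generator `u_ρ`, and a (simplicial, rational) cone by the finite set of the generators of
its rays; the cone itself is the convex cone `PointedCone.hull ℝ s`. The faces of the simplicial
cone on `s` are the cones on the subsets of `s`, and two cones of the fan meet in the common face
spanned by their common rays. -/
structure SimplicialFan (N : Submodule ℤ V) where
  cones : Finset (Finset V)
  empty_mem : ∅ ∈ cones
  down_closed : ∀ s ∈ cones, ∀ t, t ⊆ s → t ∈ cones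
  primitive : ∀ s ∈ cones, ∀ u ∈ s, IsPrimitive N u
  linearIndep : ∀ s ∈ cones, LinearIndepOn ℝ id (s : Set V)
  inter : ∀ s ∈ cones, ∀ t ∈ cones,
    (PointedCone.hull ℝ (s : Set V) : Set V) ∩ (PointedCone.hull ℝ (t : Set V) : Set V)
      = (PointedCone.hull ℝ ((s ∩ t : Finset V) : Set V) : Set V)

/-- `f` is the element dual to `α` on the generators in `s`: it takes the value `1` at `α` (if
`α ∈ s`) and `0` at all other elements of `s`. -/
def IsDualOn (s : Finset V) (α : V) (f : V →ₗ[ℝ] ℝ) : Prop :=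
  ∀ u ∈ s, f u = if u = α then 1 else 0

/-- Dual elements exist on linearly independent sets. -/
theorem exists_isDualOn {s : Finset V} (hs : LinearIndepOn ℝ id (s : Set V)) (α : V) :
    ∃ f : V →ₗ[ℝ] ℝ, IsDualOn s α f := by
  let b := Module.Basis.extend hs
  refine ⟨b.constr ℝ (fun i => if (i : V) = α then 1 else 0), fun u hu => ?_⟩
  have h := Module.Basis.constr_basis b ℝ (fun i => if (i : V) = α then (1 : ℝ) else 0)
    ⟨u, hs.subset_extend _ hu⟩
  simpa [b] using h

/-- The relative interior of the cone generated by `s`. -/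
def relInt (s : Finset V) : Set V :=
  intrinsicInterior ℝ (PointedCone.hull ℝ (s : Set V) : Set V)

namespace SimplicialFan

variable {N : Submodule ℤ V} (F : SimplicialFan N)

/-- The fan is complete: its support is the whole space. -/
def IsComplete : Prop :=
  ∀ v : V, ∃ s ∈ F.cones, v ∈ PointedCone.hull ℝ (s : Set V)

/-- The simplicial complex of cones is flag: a set of rays spans a cone of the fan as soon as its
elements are rays of the fan and any two of them span a cone of the fan. -/
def IsFlag : Prop :=
  ∀ s : Finset V, (∀ u ∈ s, ∀ v ∈ s, {u, v} ∈ F.cones) → s ∈ F.cones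

/-- Walls are the cones of codimension one. -/
def IsWall (s : Finset V) : Prop :=
  s ∈ F.cones ∧ s.card + 1 = Module.finrank ℝ V

/-- The (generators of the) rays of the link of the cone `ω`. -/
def linkRays (ω : Finset V) : Finset V :=
  (F.cones.biUnion id).filter fun ρ => ρ ∉ ω ∧ insert ρ ω ∈ F.cones

/-- The cones that contain `ω`. They index the torus-invariant subvarieties of the orbit closure
`V(ω)`, which is the toric variety of the fan formed by their images in `N_ℝ / Span ω`. -/
def star (ω : Finset V) : Finset (Finset V) :=
  F.cones.filter fun s => ω ⊆ s

end SimplicialFan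

/-- The multiplicity of the simplicial cone generated by `s`: the index of the lattice `ℤ s` in
the lattice `N ∩ Span s`. -/
def mult (N : Submodule ℤ V) (s : Finset V) : ℕ :=
  (Submodule.span ℤ (s : Set V)).toAddSubgroup.relIndex
    (N ⊓ (Submodule.span ℝ (s : Set V)).restrictScalars ℤ).toAddSubgroup

namespace SimplicialFan

variable {N : Submodule ℤ V} (F : SimplicialFan N)

/-- Real combinations of the torus-invariant subvarieties `V(s)` of `V(ω)`, `s ⊇ ω`. -/
abbrev Cycles (ω : Finset V) : Type _ := {s // s ∈ F.star ω} →₀ ℝ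

/-- The cycle `V(s)` on `V(ω)`. -/
def cycle (ω s : Finset V) : F.Cycles ω :=
  if h : s ∈ F.star ω then Finsupp.single ⟨s, h⟩ 1 else 0

/-- The divisor `div(χ^m)` on the orbit closure `V(s) ⊆ V(ω)` of a character `m ∈ s^⊥` (with real
coefficients): `∑ ⟨m, n_{ρ}⟩ V(s + ρ)` over the rays `ρ` of the link of `s`. Here `n_ρ` is the
primitive generator of the image of `ρ` in `N / N_s`, so that
`u_ρ = (mult (s + ρ) / mult s) n_ρ` there. -/
def charDiv (ω s : Finset V) (m : V →ₗ[ℝ] ℝ) : F.Cycles ω :=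
  ∑ ρ ∈ F.linkRays s,
    (m ρ * ((mult N s : ℝ) / (mult N (insert ρ s) : ℝ))) • F.cycle ω (insert ρ s)

/-- Rational equivalence on `V(ω)`: the span of the divisors of the characters `m ∈ s^⊥` on the
orbit closures `V(s) ⊆ V(ω)`. -/
def ratEquiv (ω : Finset V) : Submodule ℝ (F.Cycles ω) :=
  Submodule.span ℝ
    {c | ∃ s ∈ F.star ω, ∃ m : V →ₗ[ℝ] ℝ, (∀ u ∈ s, m u = 0) ∧ c = F.charDiv ω s m}

/-- The Chow group `A_*(V(ω))_ℝ` of the orbit closure `V(ω)` (all dimensions together).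
For `ω = ∅` this is the Chow group of the toric variety `X_Σ = V(∅)` itself. -/
abbrev Chow (ω : Finset V) : Type _ := F.Cycles ω ⧸ F.ratEquiv ω

/-- The class `[V(s)]` in the Chow group of `V(ω)`. -/
def cls (ω s : Finset V) : F.Chow ω := (F.ratEquiv ω).mkQ (F.cycle ω s)

/-- A linear function that agrees on the cone `ω` with the piecewise linear function of the ray
divisor `D_ρ` (the function with value `1` at `u_ρ` and `0` at the generators of all other rays). -/
def localEq (ω : Finset V) (ρ : V) : V →ₗ[ℝ] ℝ :=
  if h : ω ∈ F.cones then (exists_isDualOn (F.linearIndep ω h) ρ).choose else 0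

/-- The coefficient of `V(ω + ρ')` in the restriction of `D_ρ` to `V(ω)`. With `m` the linear
function of `D_ρ` on `ω`, the divisor `D_ρ - div(χ^m) = ∑_{ρ'} (δ_{ρρ'} - ⟨m, u_{ρ'}⟩) D_{ρ'}` is
linearly equivalent to `D_ρ` and no component of it contains `V(ω)`, and
`D_{ρ'} · V(ω) = (mult ω / mult (ω + ρ')) V(ω + ρ')`. -/
def restrictCoeff (ω : Finset V) (ρ ρ' : V) : ℝ :=
  ((if ρ' = ρ then 1 else 0) - F.localEq ω ρ ρ') *
    ((mult N ω : ℝ) / (mult N (insert ρ' ω) : ℝ))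

/-- The class of the restriction `D_ρ|_{V(ω)}` in the Chow group of `V(ω)`. -/
def restrict (ω : Finset V) (ρ : V) : F.Chow ω :=
  ∑ ρ' ∈ F.linkRays ω, F.restrictCoeff ω ρ ρ' • F.cls ω (insert ρ' ω)

/-- The intersection number `D_ρ · V(τ)` of a ray divisor with the curve of a wall `τ`: the degree
of the restriction of `D_ρ` to `V(τ)`. -/
def intersectionNumber (ρ : V) (τ : Finset V) : ℝ :=
  ∑ ρ' ∈ F.linkRays τ, F.restrictCoeff τ ρ ρ'

/-- The Mori cone `NE(X_Σ)`, the cone generated by the classes of the torus-invariant curves. -/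
def moriCone : PointedCone ℝ (F.Chow ∅) :=
  PointedCone.hull ℝ {c | ∃ τ, F.IsWall τ ∧ c = F.cls ∅ τ}

/-- The wall `τ` is extremal: the class `[V(τ)]` spans an extremal ray of the Mori cone. -/
def IsExtremalWall (τ : Finset V) : Prop :=
  F.IsWall τ ∧ ∀ x ∈ F.moriCone, ∀ y ∈ F.moriCone,
    x + y ∈ PointedCone.hull ℝ {F.cls ∅ τ} →
      x ∈ PointedCone.hull ℝ {F.cls ∅ τ} ∧ y ∈ PointedCone.hull ℝ {F.cls ∅ τ}

/-- The link of `ω` is the 4-gon with the four distinct vertices `a, b, c, e`, in this cyclic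
order. -/
def LinkIsFourGon (ω : Finset V) (a b c e : V) : Prop :=
  F.linkRays ω = {a, b, c, e} ∧ (F.linkRays ω).card = 4 ∧
  insert a (insert b ω) ∈ F.cones ∧ insert b (insert c ω) ∈ F.cones ∧
  insert c (insert e ω) ∈ F.cones ∧ insert e (insert a ω) ∈ F.cones ∧
  insert a (insert c ω) ∉ F.cones ∧ insert b (insert e ω) ∉ F.cones

end SimplicialFan

end ToricFan

end

/-! Put `ω = τ \ α`. Modulo `Span ω` the cones containing `ω` form a complete fan in a plane. The
condition `D_α · V(τ) = 0` forces `α*` to vanish on both `γ` and `γ'`, so `α*` descends to this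
plane, and `γ`, `γ'` become opposite there. The half plane containing `α` is filled by the cones on
`α, γ` and `α, γ'`; every other ray lies strictly on the negative side, and completeness supplies
one. `IsFlatWall` records this configuration.

The character `α*` on `V(ω)` then writes a positive multiple of `[V(τ)]` as a nonnegative
combination of the other curve classes, with positive coefficients on the negative side. Extremality
therefore puts each negative `[V(η)]` on the ray of `[V(τ)]` (`exists_cls_eq_smul`). Intersecting
with `D_γ` and `D_γ'` shows that `η` is adjacent to both rays (`left_mem_linkRays`). The wall `ω +
γ` has only two neighbours, one of them `α`, so `η` is unique and the link is a 4-gon.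

On the surface `V(ω)` the relations come from characters, and the non-proportionality and the sign
of `b` from intersecting with `D_α`. This needs intersection numbers to respect rational equivalence
(`exists_intersection_linearMap`), which rests on the degree of a character vanishing on each wall
curve and on an antisymmetric double sum. -/

namespace ToricFan

variable {V : Type*} [NormedAddCommGroup V] [NormedSpace ℝ V]

/-! ### Multiplicities as lattice indices and determinants -/

section Lattice

theorem cast_det_eq_det_ofZLatticeBasis {ι : Type*} [Fintype ι] [DecidableEq ι]
    [FiniteDimensional ℝ V] (N : Submodule ℤ V) [DiscreteTopology N] [IsZLattice ℝ N]
    (e : Module.Basis ι ℤ N) (w : ι → N) :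
    ((e.det w : ℤ) : ℝ) = (e.ofZLatticeBasis ℝ N).det (fun i => (w i : V)) := by
  change algebraMap ℤ ℝ _ = _
  rw [Module.Basis.det_apply, Module.Basis.det_apply, RingHom.map_det]
  congr 1
  ext i j
  simp [Module.Basis.toMatrix_apply]

/-- The index in a lattice of the lattice spanned by a linearly independent family of full rank is
the absolute value of the determinant. -/
theorem relIndex_span_range_eq_abs_det {ι : Type*} [Fintype ι] [DecidableEq ι]
    [FiniteDimensional ℝ V] (N : Submodule ℤ V) [DiscreteTopology N] [IsZLattice ℝ N]
    (e : Module.Basis ι ℤ N) (v : ι → V) (hv : ∀ i, v i ∈ N) (hli : LinearIndependent ℝ v) :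
    ((Submodule.span ℤ (Set.range v)).toAddSubgroup.relIndex N.toAddSubgroup : ℝ)
      = |(e.ofZLatticeBasis ℝ N).det v| := by
  have hle : (Submodule.span ℤ (Set.range v)) ≤ N := by
    rw [Submodule.span_le]; rintro _ ⟨i, rfl⟩; exact hv i
  have hliZ : LinearIndependent ℤ v :=
    hli.restrict_scalars (by intro a b h; simpa using h)
  have hw : ∀ i, (Module.Basis.span hliZ i : V) = v i := fun i =>
    congrArg Subtype.val (Module.Basis.span_apply hliZ i)
  rw [AddSubgroup.relIndex_eq_natAbs_det (Submodule.span ℤ (Set.range v)).toAddSubgroup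
    N.toAddSubgroup hle (Module.Basis.span hliZ) e, Nat.cast_natAbs, Int.cast_abs]
  refine congrArg abs ((cast_det_eq_det_ofZLatticeBasis N e
    (fun i => ⟨Module.Basis.span hliZ i, hle (SetLike.coe_mem _)⟩)).trans ?_)
  exact congrArg _ (funext hw)

theorem exists_lattice_basis {ι : Type*} [Fintype ι] [FiniteDimensional ℝ V]
    (N : Submodule ℤ V) [DiscreteTopology N] [IsZLattice ℝ N]
    (hcard : Fintype.card ι = Module.finrank ℝ V) : Nonempty (Module.Basis ι ℤ N) := by
  have : Module.Finite ℤ N := ZLattice.module_finite ℝ N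
  have : Module.Free ℤ N := ZLattice.module_free ℝ N
  exact ⟨(Module.Free.chooseBasis ℤ N).reindex (Fintype.equivOfCardEq
    (by rw [← Module.finrank_eq_card_chooseBasisIndex, ZLattice.rank ℝ, hcard]))⟩

/-- Extend `s` to a real basis `t` inside `N`. Then `ℤ t` has finite index in `N`, and `ℤ t ∩ Span s
= ℤ s`. An infinite index is recorded as `0`, so the claim is finiteness. -/
theorem mult_ne_zero [FiniteDimensional ℝ V]
    (N : Submodule ℤ V) [DiscreteTopology N] [IsZLattice ℝ N] {s : Finset V}
    (hN : ∀ u ∈ s, u ∈ N) (hs : LinearIndepOn ℝ id (s : Set V)) : mult N s ≠ 0 := by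
  obtain ⟨t, htN, hst, hspan, hli⟩ := exists_linearIndepOn_id_extension hs
    (show (s : Set V) ⊆ (N : Set V) from hN)
  have htop : ⊤ ≤ Submodule.span ℝ (Set.range ((↑) : t → V)) := by
    rw [Subtype.range_coe, ← (IsZLattice.span_top : Submodule.span ℝ (N : Set V) = ⊤)]
    exact Submodule.span_le.2 hspan
  have hli' : LinearIndependent ℝ ((↑) : t → V) := hli
  let b := Module.Basis.mk hli' htop
  have : Fintype t := FiniteDimensional.fintypeBasisIndex b
  obtain ⟨e⟩ := exists_lattice_basis (ι := t) N (Module.finrank_eq_card_basis b).symm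
  have hdet := relIndex_span_range_eq_abs_det N e (fun i : t => (i : V))
    (fun i => htN i.2) hli'
  have hne : (e.ofZLatticeBasis ℝ N).det (fun i : t => (i : V)) ≠ 0 := by
    have := (e.ofZLatticeBasis ℝ N).isUnit_det b
    simpa [b] using this.ne_zero
  have h1 : (Submodule.span ℤ (Set.range fun i : t => (i : V))).toAddSubgroup.relIndex
      N.toAddSubgroup ≠ 0 := by
    intro h0
    rw [h0, Nat.cast_zero] at hdet
    exact hne (by convert abs_eq_zero.1 hdet.symm)
  rw [Subtype.range_coe] at h1
  set K := (N ⊓ (Submodule.span ℝ (s : Set V)).restrictScalars ℤ).toAddSubgroup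
  have h2 : (Submodule.span ℤ t).toAddSubgroup.relIndex K ≠ 0 := fun h =>
    h1 (AddSubgroup.relIndex_eq_zero_of_le_right
      (show K ≤ N.toAddSubgroup from fun x hx => hx.1) h)
  rw [← AddSubgroup.inf_relIndex_right] at h2
  refine fun h => h2 (AddSubgroup.relIndex_eq_zero_of_le_left ?_ h)
  rintro x ⟨hxt, -, hxs⟩
  change x ∈ Submodule.span ℤ (s : Set V)
  have hxt' : x ∈ Submodule.span ℤ t := hxt
  have hxs' : x ∈ Submodule.span ℝ (s : Set V) := hxs
  have hb : ∀ i : t, b i = i := fun i => by simp [b]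
  have hxs'' : x ∈ Submodule.span ℝ (b '' {i : t | (i : V) ∈ s}) := by
    convert hxs' using 2
    ext y
    simp only [Set.mem_image, Set.mem_ofPred_eq, hb, Finset.mem_coe]
    exact ⟨fun ⟨i, hi, h⟩ => h ▸ hi, fun h => ⟨⟨y, hst h⟩, h, rfl⟩⟩
  have hrange : Set.range b = t := by
    rw [show (b : t → V) = (↑) from funext hb, Subtype.range_coe]
  rw [← hrange, b.mem_span_iff_repr_mem ℤ] at hxt'
  rw [b.mem_span_image] at hxs''
  rw [← b.sum_repr x]
  refine Submodule.sum_mem _ fun i _ => ?_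
  obtain ⟨k, hk⟩ := hxt' i
  by_cases hi : b.repr x i = 0
  · simp [hi]
  · have his : (i : V) ∈ s := hxs'' (Finsupp.mem_support_iff.2 hi)
    rw [← hk, hb, algebraMap_smul]
    exact Submodule.smul_mem _ _ (Submodule.subset_span his)

/-- For a linearly independent set `η` of lattice vectors of codimension one there is a linear
function vanishing on `η` whose absolute value at `ρ` is the multiplicity of `η + ρ`. -/
theorem exists_mult_insert_eq_abs [FiniteDimensional ℝ V]
    (N : Submodule ℤ V) [DiscreteTopology N] [IsZLattice ℝ N] {η : Finset V}
    (hN : ∀ u ∈ η, u ∈ N) (hcard : η.card + 1 = Module.finrank ℝ V) :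
    ∃ D : V →ₗ[ℝ] ℝ, (∀ u ∈ η, D u = 0) ∧ ∀ ρ ∈ N, ρ ∉ η →
      LinearIndepOn ℝ id ((insert ρ η : Finset V) : Set V) →
      (mult N (insert ρ η) : ℝ) = |D ρ| ∧ D ρ ≠ 0 := by
  obtain ⟨e⟩ := exists_lattice_basis (ι := Option η) N (by simpa using hcard)
  let B := e.ofZLatticeBasis ℝ N
  let v : V → Option η → V := fun ρ o => o.elim ρ (fun u => (u : V))
  have hv : ∀ ρ, v ρ = Function.update (v 0) none ρ := by
    intro ρ; funext o; cases o <;> simp [v]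
  -- The function is `ρ ↦ det (ρ, η)` in a lattice basis.
  refine ⟨B.det.toMultilinearMap.toLinearMap (v 0) none, ?_, ?_⟩
  · intro u hu
    change B.det (Function.update (v 0) none u) = 0
    rw [← hv]
    exact B.det.map_eq_zero_of_eq (v u) (i := none) (j := some ⟨u, hu⟩) rfl (by simp)
  · intro ρ hρN hρ hli
    change _ = |B.det (Function.update (v 0) none ρ)| ∧ B.det (Function.update (v 0) none ρ) ≠ 0
    rw [← hv]
    have hrange : Set.range (v ρ) = ((insert ρ η : Finset V) : Set V) := by
      ext x
      simp only [Set.mem_range, Finset.coe_insert, Set.mem_insert_iff, Finset.mem_coe]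
      constructor
      · rintro ⟨_ | u, rfl⟩
        · exact Or.inl rfl
        · exact Or.inr u.2
      · rintro (rfl | h)
        · exact ⟨none, rfl⟩
        · exact ⟨some ⟨x, h⟩, rfl⟩
    have hinj : Function.Injective (v ρ) := by
      rintro (_ | a) (_ | b) h
      · rfl
      · exact absurd (show ρ = b from h) (fun h => hρ (h ▸ b.2))
      · exact absurd (show (a : V) = ρ from h) (fun h => hρ (h ▸ a.2))
      · exact congrArg some (Subtype.ext h)
    have hliv : LinearIndependent ℝ (v ρ) := by
      rw [← linearIndepOn_id_range_iff hinj, hrange]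
      exact hli
    have hspan : Submodule.span ℝ (Set.range (v ρ)) = ⊤ :=
      hliv.span_eq_top_of_card_eq_finrank' (by simpa using hcard)
    have hdet := relIndex_span_range_eq_abs_det N e (v ρ) (by
      rintro (_ | u)
      · exact hρN
      · exact hN u u.2) hliv
    refine ⟨?_, ?_⟩
    · refine Eq.trans ?_ (Eq.trans hdet (by congr!))
      rw [mult, ← hrange, hspan]
      congr 2
      ext x
      simp
    · have := B.isUnit_det (Module.Basis.mk hliv hspan.ge)
      simpa using this.ne_zero

end Lattice

/-! ### Simplicial cones and their relative interiors -/

section Cones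

theorem mem_hull_finset_iff {s : Finset V} {x : V} :
    x ∈ PointedCone.hull ℝ (s : Set V) ↔
      ∃ c : V → ℝ, (∀ u ∈ s, 0 ≤ c u) ∧ x = ∑ u ∈ s, c u • u := by
  constructor
  · intro h
    obtain ⟨c, hc, hc0, hx⟩ := PointedCone.mem_hull_set.1 h
    refine ⟨c, fun u _ => hc0 u, ?_⟩
    rw [← hx]
    exact Finsupp.sum_of_support_subset c (fun u hu => hc hu) _ (by simp)
  · rintro ⟨c, hc, rfl⟩
    exact Submodule.sum_mem _ fun u hu =>
      Submodule.smul_mem _ (⟨c u, hc u hu⟩ : {r : ℝ // 0 ≤ r}) (Submodule.subset_span hu)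

theorem mem_span_finset_iff {s : Finset V} {x : V} :
    x ∈ Submodule.span ℝ (s : Set V) ↔ ∃ c : V → ℝ, x = ∑ u ∈ s, c u • u := by
  constructor
  · intro h
    obtain ⟨c, -, hx⟩ := Submodule.mem_span_finset.1 h
    exact ⟨c, hx.symm⟩
  · rintro ⟨c, rfl⟩
    exact Submodule.sum_mem _ fun u hu => Submodule.smul_mem _ _ (Submodule.subset_span hu)

theorem map_nonneg_of_mem_hull {s : Finset V} {f : V →ₗ[ℝ] ℝ} (hf : ∀ u ∈ s, 0 ≤ f u) {x : V}
    (hx : x ∈ PointedCone.hull ℝ (s : Set V)) : 0 ≤ f x := by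
  obtain ⟨c, hc, rfl⟩ := mem_hull_finset_iff.1 hx
  rw [map_sum]
  exact Finset.sum_nonneg fun u hu => by
    rw [map_smul]; exact mul_nonneg (hc u hu) (hf u hu)

theorem map_eq_zero_of_mem_hull {s : Finset V} {f : V →ₗ[ℝ] ℝ} (hf : ∀ u ∈ s, f u = 0) {x : V}
    (hx : x ∈ PointedCone.hull ℝ (s : Set V)) : f x = 0 := by
  obtain ⟨c, hc, rfl⟩ := mem_hull_finset_iff.1 hx
  rw [map_sum]
  exact Finset.sum_eq_zero fun u hu => by rw [map_smul, hf u hu, smul_zero]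

theorem IsDualOn.map_sum {s : Finset V} {α : V} {f : V →ₗ[ℝ] ℝ} (hf : IsDualOn s α f) (hα : α ∈ s)
    (c : V → ℝ) : f (∑ u ∈ s, c u • u) = c α := by
  rw [_root_.map_sum, Finset.sum_eq_single_of_mem α hα]
  · rw [map_smul, hf α hα]; simp
  · intro u hu hne
    rw [map_smul, hf u hu]; simp [hne]

theorem relInt_subset_hull (s : Finset V) :
    relInt s ⊆ (PointedCone.hull ℝ (s : Set V) : Set V) := intrinsicInterior_subset

theorem relInt_nonempty [FiniteDimensional ℝ V] (s : Finset V) : (relInt s).Nonempty :=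
  Set.Nonempty.intrinsicInterior (PointedCone.convex _) ⟨0, Submodule.zero_mem _⟩

/-- A linear function that is nonnegative on a cone and does not vanish on it is positive on the
relative interior. -/
theorem map_pos_of_mem_relInt {s : Finset V} {f : V →ₗ[ℝ] ℝ} (hf : ∀ u ∈ s, 0 ≤ f u) {u : V}
    (hu : u ∈ s) (hfu : 0 < f u) {z : V} (hz : z ∈ relInt s) : 0 < f z := by
  set C : Set V := (PointedCone.hull ℝ (s : Set V) : Set V) with hC
  have huC : u ∈ C := Submodule.subset_span hu
  have h0C : (0 : V) ∈ C := Submodule.zero_mem _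
  obtain ⟨y, hy, hyz⟩ := mem_intrinsicInterior.1 hz
  have hzA : z ∈ affineSpan ℝ C := hyz ▸ y.2
  -- A point of the relative interior can be moved slightly along `-u` without leaving the cone; `f
  -- ≥ 0` at the new point gives `f z ≥ t * f u > 0`.
  have hmem : ∀ t : ℝ, z - t • u ∈ affineSpan ℝ C := by
    intro t
    have hd : u -ᵥ (0 : V) ∈ (affineSpan ℝ C).direction :=
      AffineSubspace.vsub_mem_direction (subset_affineSpan ℝ C huC) (subset_affineSpan ℝ C h0C)
    have := AffineSubspace.vadd_mem_of_mem_direction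
      ((affineSpan ℝ C).direction.smul_mem (-t) hd) hzA
    convert this using 1
    simp [sub_eq_neg_add]
  let g : ℝ → affineSpan ℝ C := fun t => ⟨z - t • u, hmem t⟩
  have hg : Continuous g := by
    refine Continuous.subtype_mk ?_ _
    fun_prop
  have hg0 : g 0 = y := Subtype.ext (by simp [g, hyz])
  have hnhds : ∀ᶠ t in nhds (0 : ℝ), g t ∈ interior ((↑) ⁻¹' C : Set (affineSpan ℝ C)) :=
    hg.continuousAt.eventually_mem (by
      rw [hg0]; exact isOpen_interior.mem_nhds hy)
  obtain ⟨t, ht, ht0⟩ := ((hnhds.filter_mono nhdsWithin_le_nhds).and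
    (self_mem_nhdsWithin (s := Set.Ioi (0 : ℝ)))).exists
  have htC : z - t • u ∈ C := interior_subset (s := ((↑) ⁻¹' C : Set (affineSpan ℝ C))) ht
  have h1 := map_nonneg_of_mem_hull hf htC
  rw [map_sub, map_smul, smul_eq_mul] at h1
  have : 0 < t * f u := mul_pos ht0 hfu
  linarith

end Cones

/-! ### Links of cones in complete fans -/

namespace SimplicialFan

variable {N : Submodule ℤ V} (F : SimplicialFan N)

theorem mem_linkRays {ω : Finset V} {ρ : V} :
    ρ ∈ F.linkRays ω ↔ ρ ∉ ω ∧ insert ρ ω ∈ F.cones := by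
  simp only [linkRays, Finset.mem_filter, Finset.mem_biUnion, id, and_iff_right_iff_imp]
  exact fun h => ⟨_, h.2, Finset.mem_insert_self _ _⟩

theorem mem_star {ω s : Finset V} : s ∈ F.star ω ↔ s ∈ F.cones ∧ ω ⊆ s := by
  simp [star]

/-- If a ray of a cone `t` lies in the cone `s` modulo the span of a common face, then it is a ray
of `s`. -/
theorem mem_of_eq_sum {ω s t : Finset V} (hs : s ∈ F.cones) (ht : t ∈ F.cones) (hωs : ω ⊆ s)
    (hωt : ω ⊆ t) {ρ : V} (hρ : ρ ∈ t) {c : V → ℝ} (hc : ∀ u ∈ s, u ∉ ω → 0 ≤ c u)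
    (h : ρ = ∑ u ∈ s, c u • u) : ρ ∈ s := by
  by_contra hρs
  have hρω : ρ ∉ ω := fun h => hρs (hωs h)
  -- Adding `p` cancels the possibly negative coefficients on `ω`, so `ρ + p` lies in both cones,
  -- hence in their common face, where the dual of `ρ` vanishes.
  let p : V := ∑ u ∈ ω, |c u| • u
  have hps : ρ + p = ∑ u ∈ s, (c u + if u ∈ ω then |c u| else 0) • u := by
    simp only [add_smul, Finset.sum_add_distrib, ite_smul, zero_smul, ← h, p]
    rw [← Finset.sum_filter, Finset.filter_mem_eq_inter, Finset.inter_eq_right.2 hωs]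
  have h1 : ρ + p ∈ PointedCone.hull ℝ (s : Set V) := by
    refine mem_hull_finset_iff.2 ⟨_, fun u hu => ?_, hps⟩
    split_ifs with hω
    · linarith [neg_abs_le (c u)]
    · simpa using hc u hu hω
  have h2 : ρ + p ∈ PointedCone.hull ℝ (t : Set V) :=
    Submodule.add_mem _ (Submodule.subset_span hρ) (Submodule.span_mono hωt
      (mem_hull_finset_iff.2 ⟨fun u => |c u|, fun u _ => abs_nonneg _, rfl⟩))
  have h3 : ρ + p ∈ (PointedCone.hull ℝ ((s ∩ t : Finset V) : Set V) : Set V) :=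
    F.inter s hs t ht ▸ ⟨h1, h2⟩
  obtain ⟨f, hf⟩ := exists_isDualOn (F.linearIndep t ht) ρ
  have h4 : f (ρ + p) = 0 := map_eq_zero_of_mem_hull (fun u hu => by
    rw [hf u (Finset.mem_inter.1 hu).2, if_neg]
    rintro rfl
    exact hρs (Finset.mem_inter.1 hu).1) h3
  have h5 : f p = 0 := by
    rw [map_sum]
    refine Finset.sum_eq_zero fun u hu => ?_
    rw [map_smul, hf u (hωt hu), if_neg (by rintro rfl; exact hρω hu), smul_zero]
  rw [map_add, h5, hf ρ hρ] at h4
  simp at h4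

/-- In a complete fan every vector lies, modulo the span of a cone `ω`, in a cone containing
`ω`. -/
theorem exists_eq_sum_of_isComplete (hF : F.IsComplete) {ω : Finset V} (hω : ω ∈ F.cones) (v : V) :
    ∃ s ∈ F.cones, ω ⊆ s ∧ ∃ c : V → ℝ, (∀ u ∈ s, u ∉ ω → 0 ≤ c u) ∧ v = ∑ u ∈ s, c u • u := by
  -- Move `v` far in the direction of an interior point `p` of `ω`. Infinitely many of the points `v
  -- + n p` share one cone `s`; letting `n` grow forces `p ∈ s`, and then `ω ⊆ s`.
  let p : V := ∑ u ∈ ω, u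
  choose S hS hvS using fun n : ℕ => hF (v + (n : ℝ) • p)
  obtain ⟨⟨s, hs⟩, hinf⟩ := Finite.exists_infinite_fiber
    (fun n : ℕ => (⟨S n, hS n⟩ : {s // s ∈ F.cones}))
  rw [Set.infinite_coe_iff] at hinf
  have hmem : ∀ n, S n = s → v + (n : ℝ) • p ∈ PointedCone.hull ℝ (s : Set V) :=
    fun n hn => hn ▸ hvS n
  have hex : ∀ m : ℕ, ∃ n, m < n ∧ S n = s := fun m => by
    obtain ⟨n, hn, hmn⟩ := hinf.exists_gt m
    exact ⟨n, hmn, congrArg Subtype.val hn⟩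
  have hspan : p ∈ Submodule.span ℝ (s : Set V) := by
    obtain ⟨n, -, hn⟩ := hex 0
    obtain ⟨m, hnm, hm⟩ := hex n
    have h1 := PointedCone.hull_le_span ℝ _ (hmem n hn)
    have h2 := PointedCone.hull_le_span ℝ _ (hmem m hm)
    have h3 : ((m : ℝ) - n) • p ∈ Submodule.span ℝ (s : Set V) := by
      have := Submodule.sub_mem (Submodule.span ℝ (s : Set V)) h2 h1
      convert this using 1
      module
    have hne : (m : ℝ) - n ≠ 0 := sub_ne_zero.2 (by exact_mod_cast hnm.ne')
    exact (Submodule.smul_mem_iff _ hne).1 h3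
  obtain ⟨c, hc⟩ := mem_span_finset_iff.1 hspan
  have hps : p ∈ PointedCone.hull ℝ (s : Set V) := by
    refine mem_hull_finset_iff.2 ⟨c, fun u hu => ?_, hc⟩
    by_contra hneg
    push Not at hneg
    obtain ⟨f, hf⟩ := exists_isDualOn (F.linearIndep s hs) u
    have hfp : f p = c u := by rw [hc, hf.map_sum hu]
    obtain ⟨k, hk⟩ := exists_nat_gt (f v / (-c u))
    obtain ⟨n, hkn, hn⟩ := hex k
    have h1 : 0 ≤ f (v + (n : ℝ) • p) := map_nonneg_of_mem_hull (fun w hw => by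
      rw [hf w hw]; split_ifs <;> norm_num) (hmem n hn)
    rw [map_add, map_smul, hfp, smul_eq_mul] at h1
    have h2 : f v / (-c u) < n := hk.trans (by exact_mod_cast hkn)
    rw [div_lt_iff₀ (by linarith)] at h2
    linarith
  have hωs : ω ⊆ s := by
    intro u hu
    by_contra hus
    have hpω : p ∈ PointedCone.hull ℝ (ω : Set V) :=
      Submodule.sum_mem _ fun w hw => Submodule.subset_span hw
    have h3 : p ∈ (PointedCone.hull ℝ ((s ∩ ω : Finset V) : Set V) : Set V) :=
      F.inter s hs ω hω ▸ ⟨hps, hpω⟩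
    obtain ⟨f, hf⟩ := exists_isDualOn (F.linearIndep ω hω) u
    have h4 : f p = 0 := map_eq_zero_of_mem_hull (fun w hw => by
      rw [hf w (Finset.mem_inter.1 hw).2, if_neg]
      rintro rfl
      exact hus (Finset.mem_inter.1 hw).1) h3
    have h5 : f p = 1 := by
      have := hf.map_sum hu (fun _ => 1)
      simpa only [one_smul] using this
    linarith
  obtain ⟨n, -, hn⟩ := hex 0
  obtain ⟨a, ha, hva⟩ := mem_hull_finset_iff.1 (hmem n hn)
  refine ⟨s, hs, hωs, fun u => a u - if u ∈ ω then (n : ℝ) else 0, ?_, ?_⟩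
  · intro u hu huω
    simpa [huω] using ha u hu
  · simp only [sub_smul, Finset.sum_sub_distrib, ite_smul, zero_smul, ← hva]
    rw [← Finset.sum_filter, Finset.filter_mem_eq_inter, Finset.inter_eq_right.2 hωs,
      ← Finset.smul_sum]
    simp [p]

/-- In a complete fan, the link of `ω` meets every open half space bounded by a hyperplane
containing `ω`. -/
theorem exists_mem_linkRays_pos (hF : F.IsComplete) {ω : Finset V} (hω : ω ∈ F.cones)
    {f : V →ₗ[ℝ] ℝ} (hf : ∀ u ∈ ω, f u = 0) {v : V} (hv : 0 < f v) :
    ∃ ρ ∈ F.linkRays ω, 0 < f ρ := by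
  obtain ⟨s, hs, hωs, c, hc, rfl⟩ := F.exists_eq_sum_of_isComplete hF hω v
  by_contra! hneg
  refine absurd hv (not_lt.2 ?_)
  rw [map_sum]
  refine Finset.sum_nonpos fun u hu => ?_
  rw [map_smul, smul_eq_mul]
  by_cases huω : u ∈ ω
  · simp [hf u huω]
  · exact mul_nonpos_of_nonneg_of_nonpos (hc u hu huω) (hneg u (F.mem_linkRays.2
      ⟨huω, F.down_closed s hs _ (Finset.insert_subset hu hωs)⟩))

/-! ### The two sides of a wall -/

section Walls

variable [FiniteDimensional ℝ V] {F}

theorem IsWall.span_insert_eq_top {η : Finset V} (hη : F.IsWall η) {ρ : V}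
    (hρ : ρ ∈ F.linkRays η) : Submodule.span ℝ ((insert ρ η : Finset V) : Set V) = ⊤ := by
  obtain ⟨hρη, hcone⟩ := F.mem_linkRays.1 hρ
  have h := LinearIndependent.span_eq_top_of_card_eq_finrank'
    (b := fun u : (insert ρ η : Finset V) => (u : V)) (F.linearIndep _ hcone)
    (by rw [Fintype.card_coe, Finset.card_insert_of_notMem hρη, hη.2])
  rwa [Subtype.range_coe_subtype] at h

theorem IsWall.eq_zero_of_vanish {η : Finset V} (hη : F.IsWall η) {ρ : V}
    (hρ : ρ ∈ F.linkRays η) {f : V →ₗ[ℝ] ℝ} (hf : ∀ u ∈ η, f u = 0) (hfρ : f ρ = 0) : f = 0 := by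
  refine LinearMap.ext_on (hη.span_insert_eq_top hρ) fun u hu => ?_
  rcases Finset.mem_insert.1 hu with rfl | hu
  · simpa using hfρ
  · simpa using hf u hu

/-- On one side of the wall, `ρ'` is a positive multiple of `ρ` modulo `Span η`, so `mem_of_eq_sum`
makes it a ray of `η + ρ`. -/
theorem IsWall.linkRays_unique {η : Finset V} (hη : F.IsWall η) {ρ ρ' : V}
    (hρ : ρ ∈ F.linkRays η) (hρ' : ρ' ∈ F.linkRays η) {f : V →ₗ[ℝ] ℝ} (hf : ∀ u ∈ η, f u = 0)
    (hpos : 0 < f ρ) (hpos' : 0 < f ρ') : ρ' = ρ := by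
  obtain ⟨hρη, hcone⟩ := F.mem_linkRays.1 hρ
  obtain ⟨hρη', hcone'⟩ := F.mem_linkRays.1 hρ'
  obtain ⟨c, hc⟩ := mem_span_finset_iff.1 (show ρ' ∈ Submodule.span ℝ
    ((insert ρ η : Finset V) : Set V) by rw [hη.span_insert_eq_top hρ]; trivial)
  have h1 : f ρ' = c ρ * f ρ := by
    rw [hc, map_sum, Finset.sum_insert hρη, map_smul, smul_eq_mul, Finset.sum_eq_zero, add_zero]
    intro u hu
    rw [map_smul, hf u hu, smul_zero]
  have hcρ : 0 < c ρ := by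
    rw [h1] at hpos'
    exact pos_of_mul_pos_left hpos' hpos.le
  have := F.mem_of_eq_sum hcone hcone' (Finset.subset_insert _ _) (Finset.subset_insert _ _)
    (Finset.mem_insert_self _ _) (fun u hu huη => by
      rcases Finset.mem_insert.1 hu with rfl | hu
      · exact hcρ.le
      · exact absurd hu huη) hc
  exact (Finset.mem_insert.1 this).resolve_right hρη'

/-- In a complete fan the link of a wall consists of two rays on opposite sides. -/
theorem IsWall.exists_linkRays_eq_pair (hF : F.IsComplete) {η : Finset V} (hη : F.IsWall η) :
    ∃ ρ ρ' : V, ρ ≠ ρ' ∧ F.linkRays η = {ρ, ρ'} ∧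
      ∃ a : ℝ, 0 < a ∧ ∀ f : V →ₗ[ℝ] ℝ, (∀ u ∈ η, f u = 0) → f ρ' = -a * f ρ := by
  have hlt : Submodule.span ℝ (η : Set V) < ⊤ := by
    refine lt_top_iff_ne_top.2 fun h => ?_
    have h1 := finrank_span_finset_le_card (R := ℝ) η
    rw [Set.finrank, h, finrank_top] at h1
    have := hη.2
    omega
  obtain ⟨g, hg0, hg⟩ := Submodule.exists_le_ker_of_lt_top _ hlt
  have hgη : ∀ u ∈ η, g u = 0 := fun u hu => hg (Submodule.subset_span hu)
  obtain ⟨v, hv⟩ : ∃ v, 0 < g v := by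
    by_contra! h
    refine hg0 (LinearMap.ext fun v => le_antisymm (h v) ?_)
    have := h (-v)
    rw [map_neg] at this
    simpa using this
  obtain ⟨ρ, hρ, hgρ⟩ := F.exists_mem_linkRays_pos hF hη.1 hgη hv
  have hgη' : ∀ u ∈ η, (-g) u = 0 := fun u hu => by simp [hgη u hu]
  obtain ⟨ρ', hρ', hgρ'⟩ := F.exists_mem_linkRays_pos hF hη.1 hgη' (v := -v) (by simpa using hv)
  have hgρ'' : g ρ' < 0 := by simpa using hgρ'
  refine ⟨ρ, ρ', ?_, ?_, -g ρ' / g ρ, div_pos (by linarith) hgρ, fun f hf => ?_⟩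
  · rintro rfl
    linarith
  · ext x
    simp only [Finset.mem_insert, Finset.mem_singleton]
    constructor
    · intro hx
      rcases lt_trichotomy (g x) 0 with h | h | h
      · exact Or.inr (hη.linkRays_unique hρ' hx hgη' hgρ' (by simpa using h))
      · exact absurd (hη.eq_zero_of_vanish hx hgη h) hg0
      · exact Or.inl (hη.linkRays_unique hρ hx hgη hgρ h)
    · rintro (rfl | rfl) <;> assumption
  -- Functions vanishing on `η` form a line, so the ratio of values at `ρ'` and `ρ` can be read off
  -- from `g`.
  · have h0 : g ρ • f - f ρ • g = 0 := hη.eq_zero_of_vanish hρ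
      (fun u hu => by simp [hf u hu, hgη u hu]) (by simp; ring)
    have h1 := LinearMap.congr_fun h0 ρ'
    simp at h1
    field_simp
    linarith

theorem IsWall.linkRays_eq_pair (hF : F.IsComplete) {η : Finset V} (hη : F.IsWall η) {ρ ρ' : V}
    (hρ : ρ ∈ F.linkRays η) (hρ' : ρ' ∈ F.linkRays η) (hne : ρ ≠ ρ') :
    F.linkRays η = {ρ, ρ'} ∧
      ∃ a : ℝ, 0 < a ∧ ∀ f : V →ₗ[ℝ] ℝ, (∀ u ∈ η, f u = 0) → f ρ' = -a * f ρ := by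
  obtain ⟨x, y, -, hlink, a, ha, hf⟩ := hη.exists_linkRays_eq_pair hF
  rw [hlink] at hρ hρ' ⊢
  simp only [Finset.mem_insert, Finset.mem_singleton] at hρ hρ'
  rcases hρ with rfl | rfl <;> rcases hρ' with rfl | rfl
  · exact absurd rfl hne
  · exact ⟨rfl, a, ha, hf⟩
  · refine ⟨Finset.pair_comm _ _, a⁻¹, inv_pos.2 ha, fun f hfη => ?_⟩
    rw [hf f hfη]
    field_simp
  · exact absurd rfl hne

variable [DiscreteTopology N] [IsZLattice ℝ N]

theorem mult_pos {s : Finset V} (hs : s ∈ F.cones) : 0 < (mult N s : ℝ) := by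
  have := mult_ne_zero N (fun u hu => (F.primitive s hs u hu).1) (F.linearIndep s hs)
  positivity

/-- The divisor of a character on the curve of a wall has degree zero. -/
theorem IsWall.sum_linkRays_div_mult (hF : F.IsComplete) {η : Finset V} (hη : F.IsWall η)
    {f : V →ₗ[ℝ] ℝ} (hf : ∀ u ∈ η, f u = 0) :
    ∑ ρ ∈ F.linkRays η, f ρ / (mult N (insert ρ η) : ℝ) = 0 := by
  obtain ⟨ρ, ρ', hne, hlink, a, ha, hopp⟩ := hη.exists_linkRays_eq_pair hF
  obtain ⟨D, hD, hmult⟩ := exists_mult_insert_eq_abs N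
    (fun u hu => (F.primitive η hη.1 u hu).1) hη.2
  have hm : ∀ x ∈ F.linkRays η, (mult N (insert x η) : ℝ) = |D x| ∧ D x ≠ 0 := fun x hx => by
    obtain ⟨hxη, hcone⟩ := F.mem_linkRays.1 hx
    exact hmult x (F.primitive _ hcone x (Finset.mem_insert_self _ _)).1 hxη
      (F.linearIndep _ hcone)
  have h1 := hm ρ (by simp [hlink])
  have h2 := hm ρ' (by simp [hlink])
  -- Both `f` and `D` scale by `-a` from `ρ` to `ρ'`; since the multiplicities are `|D|`, the two
  -- terms cancel.
  rw [hlink, Finset.sum_pair hne, h1.1, h2.1, hopp f hf, hopp D hD, abs_mul, abs_neg, abs_of_pos ha]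
  have := abs_pos.2 h1.2
  field_simp
  ring

end Walls

/-! ### Character relations and intersection numbers -/

theorem isDualOn_localEq {ω : Finset V} (hω : ω ∈ F.cones) (ρ : V) :
    IsDualOn ω ρ (F.localEq ω ρ) := by
  rw [localEq, dif_pos hω]
  exact (exists_isDualOn (F.linearIndep ω hω) ρ).choose_spec

theorem insert_mem_linkRays_comm {s : Finset V} {ρ ρ' : V} (hρ : ρ ∈ F.linkRays s)
    (hρ' : ρ' ∈ F.linkRays (insert ρ s)) :
    ρ' ∈ F.linkRays s ∧ ρ ∈ F.linkRays (insert ρ' s) := by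
  simp only [mem_linkRays, Finset.mem_insert, not_or] at hρ hρ' ⊢
  refine ⟨⟨hρ'.1.2, F.down_closed _ hρ'.2 _ (Finset.insert_subset_insert _
    (Finset.subset_insert _ _))⟩, ⟨Ne.symm hρ'.1.1, hρ.1⟩, ?_⟩
  rw [Finset.insert_comm]
  exact hρ'.2

theorem cycle_of_mem {ω s : Finset V} (h : s ∈ F.star ω) :
    F.cycle ω s = Finsupp.single ⟨s, h⟩ 1 := dif_pos h

theorem insert_mem_star {ω s : Finset V} (hs : s ∈ F.star ω) {ρ : V} (hρ : ρ ∈ F.linkRays s) :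
    insert ρ s ∈ F.star ω :=
  F.mem_star.2 ⟨(F.mem_linkRays.1 hρ).2, (F.mem_star.1 hs).2.trans (Finset.subset_insert _ _)⟩

/-- The relation between classes given by the divisor of a character. -/
theorem sum_linkRays_smul_cls {ω s : Finset V} (hs : s ∈ F.star ω) {m : V →ₗ[ℝ] ℝ}
    (hm : ∀ u ∈ s, m u = 0) :
    ∑ ρ ∈ F.linkRays s,
      (m ρ * ((mult N s : ℝ) / (mult N (insert ρ s) : ℝ))) • F.cls ω (insert ρ s) = 0 := by
  have h : (F.ratEquiv ω).mkQ (F.charDiv ω s m) = 0 := by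
    rw [Submodule.mkQ_apply, Submodule.Quotient.mk_eq_zero]
    exact Submodule.subset_span ⟨s, hs, m, hm, rfl⟩
  simp only [charDiv, map_sum, map_smul] at h
  exact h

/-- The restriction of `D_ρ` to `V(ω)` is a multiple of `V(ω + ρ)` for a ray `ρ` of the link. -/
theorem restrict_eq_smul_cls {ω : Finset V} (hω : ω ∈ F.cones) {ρ : V} (hρ : ρ ∈ F.linkRays ω) :
    F.restrict ω ρ = ((mult N ω : ℝ) / (mult N (insert ρ ω) : ℝ)) • F.cls ω (insert ρ ω) := by
  have hvanish : ∀ u ∈ ω, F.localEq ω ρ u = 0 := fun u hu => by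
    rw [F.isDualOn_localEq hω ρ u hu, if_neg]
    rintro rfl
    exact (F.mem_linkRays.1 hρ).1 hu
  have h := F.sum_linkRays_smul_cls (F.mem_star.2 ⟨hω, subset_rfl⟩) hvanish
  simp only [restrict, restrictCoeff, sub_mul, sub_smul, Finset.sum_sub_distrib, h, sub_zero]
  rw [Finset.sum_eq_single_of_mem ρ hρ (fun x _ hx => by simp [hx])]
  simp

section Intersection

variable [FiniteDimensional ℝ V] [DiscreteTopology N] [IsZLattice ℝ N] {F}

/-- The intersection number of `D_ρ` with a wall, computed with any local equation of `D_ρ`. -/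
theorem IsWall.intersectionNumber_eq (hF : F.IsComplete) {η : Finset V} (hη : F.IsWall η) {ρ : V}
    {f : V →ₗ[ℝ] ℝ} (hf : IsDualOn η ρ f) :
    F.intersectionNumber ρ η =
      mult N η * ∑ x ∈ F.linkRays η, ((if x = ρ then 1 else 0) - f x) / mult N (insert x η) := by
  have h := hη.sum_linkRays_div_mult hF (f := f - F.localEq η ρ) (fun u hu => by
    rw [LinearMap.sub_apply, hf u hu, F.isDualOn_localEq hη.1 ρ u hu, sub_self])
  have e : F.intersectionNumber ρ η =
      mult N η * ∑ x ∈ F.linkRays η, ((if x = ρ then 1 else 0) - f x) / mult N (insert x η) +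
        mult N η * ∑ x ∈ F.linkRays η, (f - F.localEq η ρ) x / mult N (insert x η) := by
    rw [← mul_add, ← Finset.sum_add_distrib, Finset.mul_sum, intersectionNumber]
    refine Finset.sum_congr rfl fun x _ => ?_
    rw [restrictCoeff, LinearMap.sub_apply]
    ring
  rw [e, h, mul_zero, add_zero]

theorem IsWall.intersectionNumber_of_mem_linkRays (hF : F.IsComplete) {η : Finset V}
    (hη : F.IsWall η) {ρ : V} (hρ : ρ ∈ F.linkRays η) :
    F.intersectionNumber ρ η = mult N η / mult N (insert ρ η) := by
  rw [hη.intersectionNumber_eq hF (f := 0) (fun u hu => by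
    rw [if_neg]
    · rfl
    · rintro rfl; exact (F.mem_linkRays.1 hρ).1 hu),
    Finset.sum_eq_single_of_mem ρ hρ (fun x _ hx => by simp [hx])]
  simp [div_eq_mul_inv]

theorem IsWall.intersectionNumber_pos (hF : F.IsComplete) {η : Finset V}
    (hη : F.IsWall η) {ρ : V} (hρ : ρ ∈ F.linkRays η) : 0 < F.intersectionNumber ρ η := by
  rw [hη.intersectionNumber_of_mem_linkRays hF hρ]
  exact div_pos (mult_pos hη.1) (mult_pos (F.mem_linkRays.1 hρ).2)

theorem IsWall.intersectionNumber_eq_zero (hF : F.IsComplete) {η : Finset V}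
    (hη : F.IsWall η) {ρ : V} (hρη : ρ ∉ η) (hρ : ρ ∉ F.linkRays η) :
    F.intersectionNumber ρ η = 0 := by
  rw [hη.intersectionNumber_eq hF (f := 0) (fun u hu => by
    rw [if_neg]
    · rfl
    · rintro rfl; exact hρη hu), Finset.sum_eq_zero, mul_zero]
  intro x hx
  rw [if_neg (by rintro rfl; exact hρ hx)]
  simp

/-- The intersection number of a Cartier divisor with a principal divisor on a complete toric
surface vanishes. -/
theorem sum_linkRays_mul_intersectionNumber (hF : F.IsComplete) {s : Finset V} (hs : s ∈ F.cones)
    (hcard : s.card + 2 = Module.finrank ℝ V) {m : V →ₗ[ℝ] ℝ} (hm : ∀ u ∈ s, m u = 0) (ρ : V) :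
    ∑ x ∈ F.linkRays s, (m x * ((mult N s : ℝ) / (mult N (insert x s) : ℝ))) *
      F.intersectionNumber ρ (insert x s) = 0 := by
  let φ : V → ℝ := fun x => (if x = ρ then 1 else 0) - F.localEq s ρ x
  have hdual := F.isDualOn_localEq hs ρ
  have key : ∀ x ∈ F.linkRays s, (m x * ((mult N s : ℝ) / (mult N (insert x s) : ℝ))) *
      F.intersectionNumber ρ (insert x s) = mult N s * ∑ y ∈ F.linkRays (insert x s),
        (m x * φ y - φ x * m y) / mult N (insert y (insert x s)) := by
    intro x hx
    obtain ⟨hxs, hcone⟩ := F.mem_linkRays.1 hx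
    have hwall : F.IsWall (insert x s) :=
      ⟨hcone, by rw [Finset.card_insert_of_notMem hxs, ← hcard]⟩
    have hpos := mult_pos hcone
    -- If `m x = 0`, then `m` vanishes on the wall and both sides are zero by the degree relation.
    -- Otherwise adding `(φ x / m x) • m` corrects the local equation on `s` to one on `s + x`.
    by_cases hmx : m x = 0
    · have h := hwall.sum_linkRays_div_mult hF (f := m) (fun u hu => by
        rcases Finset.mem_insert.1 hu with rfl | hu
        exacts [hmx, hm u hu])
      have h2 : ∑ y ∈ F.linkRays (insert x s),
          (m x * φ y - φ x * m y) / (mult N (insert y (insert x s)) : ℝ) =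
          -φ x * ∑ y ∈ F.linkRays (insert x s), m y / (mult N (insert y (insert x s)) : ℝ) := by
        rw [Finset.mul_sum]
        refine Finset.sum_congr rfl fun y _ => ?_
        rw [hmx]
        ring
      rw [h2, h, hmx]
      ring
    · have hf : IsDualOn (insert x s) ρ (F.localEq s ρ + (φ x / m x) • m) := by
        intro u hu
        rcases Finset.mem_insert.1 hu with rfl | hu
        · simp [φ, hmx]
        · simp [hm u hu, hdual u hu]
      rw [hwall.intersectionNumber_eq hF hf, Finset.mul_sum, Finset.mul_sum, Finset.mul_sum]
      refine Finset.sum_congr rfl fun y _ => ?_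
      simp only [LinearMap.add_apply, LinearMap.smul_apply, smul_eq_mul]
      have h3 : (if y = ρ then (1 : ℝ) else 0) = φ y + F.localEq s ρ y := by simp [φ]
      rw [h3]
      field_simp
      ring
  rw [Finset.sum_congr rfl key, ← Finset.mul_sum]
  -- The summand is antisymmetric in `x, y`, while the set of ordered adjacent pairs is symmetric.
  set A : V → V → ℝ := fun x y => (m x * φ y - φ x * m y) / mult N (insert y (insert x s))
  have hanti : ∀ x y, A y x = -A x y := fun x y => by
    simp only [A]
    rw [Finset.insert_comm, ← neg_div]
    congr 1
    ring
  have hcomm : ∑ x ∈ F.linkRays s, ∑ y ∈ F.linkRays (insert x s), A x y =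
      ∑ x ∈ F.linkRays s, ∑ y ∈ F.linkRays (insert x s), A y x :=
    Finset.sum_comm' fun x y => ⟨fun h => (F.insert_mem_linkRays_comm h.1 h.2).symm,
      fun h => F.insert_mem_linkRays_comm h.2 h.1⟩
  have hneg : ∑ x ∈ F.linkRays s, ∑ y ∈ F.linkRays (insert x s), A y x =
      -∑ x ∈ F.linkRays s, ∑ y ∈ F.linkRays (insert x s), A x y := by
    rw [← Finset.sum_neg_distrib]
    refine Finset.sum_congr rfl fun x _ => ?_
    rw [← Finset.sum_neg_distrib]
    exact Finset.sum_congr rfl fun y _ => hanti x y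
  rw [show ∑ x ∈ F.linkRays s, ∑ y ∈ F.linkRays (insert x s), A x y = 0 by linarith, mul_zero]

/-- Intersection with `D_ρ` is a well defined linear function on the Chow group of `V(ω)`. -/
theorem exists_intersection_linearMap (hF : F.IsComplete) (ω : Finset V) (ρ : V) :
    ∃ L : F.Chow ω →ₗ[ℝ] ℝ, ∀ η, F.IsWall η → ω ⊆ η →
      L (F.cls ω η) = F.intersectionNumber ρ η := by
  -- Cycles of other dimensions are sent to `0`, so only character divisors on surfaces need
  -- checking.
  let L₀ : F.Cycles ω →ₗ[ℝ] ℝ := Finsupp.linearCombination ℝ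
    (fun s => if F.IsWall s.1 then F.intersectionNumber ρ s.1 else 0)
  have hL₀ : ∀ s ∈ F.star ω, L₀ (F.cycle ω s) =
      if F.IsWall s then F.intersectionNumber ρ s else 0 := fun s hs => by
    rw [F.cycle_of_mem hs]
    simp [L₀]
  have hker : F.ratEquiv ω ≤ LinearMap.ker L₀ := by
    refine Submodule.span_le.2 ?_
    rintro _ ⟨s, hs, m, hm, rfl⟩
    rw [SetLike.mem_coe, LinearMap.mem_ker, charDiv, map_sum]
    rw [Finset.sum_congr rfl fun x hx => by
      rw [map_smul, hL₀ _ (F.insert_mem_star hs hx), smul_eq_mul]]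
    by_cases hcard : s.card + 2 = Module.finrank ℝ V
    · refine Eq.trans (Finset.sum_congr rfl fun x hx => ?_)
        (sum_linkRays_mul_intersectionNumber hF (F.mem_star.1 hs).1 hcard hm ρ)
      obtain ⟨hxs, hcone⟩ := F.mem_linkRays.1 hx
      rw [if_pos ⟨hcone, by rw [Finset.card_insert_of_notMem hxs, ← hcard]⟩]
    · refine Finset.sum_eq_zero fun x hx => ?_
      rw [if_neg, mul_zero]
      rintro ⟨-, h⟩
      rw [Finset.card_insert_of_notMem (F.mem_linkRays.1 hx).1] at h
      exact hcard h
  refine ⟨(F.ratEquiv ω).liftQ L₀ hker, fun η hη hωη => ?_⟩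
  rw [cls, Submodule.mkQ_apply, Submodule.liftQ_apply, hL₀ _ (F.mem_star.2 ⟨hη.1, hωη⟩), if_pos hη]

end Intersection

end SimplicialFan

/-! ### Flat walls -/

namespace SimplicialFan

variable {N : Submodule ℤ V} {F : SimplicialFan N}

theorem IsWall.exists_eq_insert {η ω : Finset V} (hη : F.IsWall η)
    (hcard : ω.card + 2 = Module.finrank ℝ V) (hωη : ω ⊆ η) :
    ∃ β ∈ F.linkRays ω, η = insert β ω := by
  have h1 : (η \ ω).card = 1 := by
    have := hη.2
    rw [Finset.card_sdiff_of_subset hωη]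
    omega
  obtain ⟨β, hβ⟩ := Finset.card_eq_one.1 h1
  have hβ' : β ∈ η \ ω := hβ ▸ Finset.mem_singleton_self β
  have hη' : η = insert β ω := by
    rw [← Finset.sdiff_union_of_subset hωη, hβ, Finset.insert_eq]
  exact ⟨β, F.mem_linkRays.2 ⟨(Finset.mem_sdiff.1 hβ').2, hη' ▸ hη.1⟩, hη'⟩

theorem isWall_insert {ω : Finset V} (hcard : ω.card + 2 = Module.finrank ℝ V) {β : V}
    (hβ : β ∈ F.linkRays ω) : F.IsWall (insert β ω) := by
  obtain ⟨h1, h2⟩ := F.mem_linkRays.1 hβ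
  exact ⟨h2, by rw [Finset.card_insert_of_notMem h1, ← hcard]⟩

/-- The configuration of a codimension two cone `ω`, a wall `ω + α` with the two adjacent rays `γ`,
`γ'`, and a linear function `f` vanishing on `ω`, `γ`, `γ'` and taking the value `1` at `α`. -/
structure IsFlatWall (F : SimplicialFan N) (ω : Finset V) (α γ γ' : V) (f : V →ₗ[ℝ] ℝ) : Prop where
  isComplete : F.IsComplete
  card_add_two : ω.card + 2 = Module.finrank ℝ V
  mem_link : α ∈ F.linkRays ω
  mem_left : γ ∈ F.linkRays (insert α ω)
  mem_right : γ' ∈ F.linkRays (insert α ω)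
  ne : γ ≠ γ'
  vanish : ∀ u ∈ ω, f u = 0
  map_self : f α = 1
  map_left : f γ = 0
  map_right : f γ' = 0

namespace IsFlatWall

variable {ω : Finset V} {α γ γ' : V} {f : V →ₗ[ℝ] ℝ}

theorem symm (h : IsFlatWall F ω α γ γ' f) : IsFlatWall F ω α γ' γ f :=
  ⟨h.isComplete, h.card_add_two, h.mem_link, h.mem_right, h.mem_left, h.ne.symm, h.vanish,
    h.map_self, h.map_right, h.map_left⟩

theorem isWall (h : IsFlatWall F ω α γ γ' f) : F.IsWall (insert α ω) :=
  isWall_insert h.card_add_two h.mem_link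

theorem mem_cones (h : IsFlatWall F ω α γ γ' f) : ω ∈ F.cones :=
  F.down_closed _ h.isWall.1 _ (Finset.subset_insert _ _)

theorem left_mem_link (h : IsFlatWall F ω α γ γ' f) : γ ∈ F.linkRays ω :=
  (F.insert_mem_linkRays_comm h.mem_link h.mem_left).1

theorem self_mem_link_left (h : IsFlatWall F ω α γ γ' f) : α ∈ F.linkRays (insert γ ω) :=
  (F.insert_mem_linkRays_comm h.mem_link h.mem_left).2

theorem notMem (h : IsFlatWall F ω α γ γ' f) : α ∉ ω := (F.mem_linkRays.1 h.mem_link).1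

theorem self_ne_left (h : IsFlatWall F ω α γ γ' f) : α ≠ γ := by
  rintro rfl
  exact (F.mem_linkRays.1 h.mem_left).1 (Finset.mem_insert_self _ _)

theorem ne_of_map_neg (h : IsFlatWall F ω α γ γ' f) {β : V} (hβ : f β < 0) :
    β ≠ α ∧ β ≠ γ ∧ β ≠ γ' := by
  refine ⟨?_, ?_, ?_⟩ <;> rintro rfl
  · linarith [h.map_self]
  · linarith [h.map_left]
  · linarith [h.map_right]

variable [FiniteDimensional ℝ V]

theorem linkRays_eq (h : IsFlatWall F ω α γ γ' f) : F.linkRays (insert α ω) = {γ, γ'} :=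
  (h.isWall.linkRays_eq_pair h.isComplete h.mem_left h.mem_right h.ne).1

/-- Modulo the span of `ω` the rays `γ` and `γ'` are opposite. -/
theorem exists_opposite (h : IsFlatWall F ω α γ γ' f) :
    ∃ a : ℝ, 0 < a ∧ ∀ g : V →ₗ[ℝ] ℝ, (∀ u ∈ ω, g u = 0) → g γ' = -a * g γ := by
  obtain ⟨-, a, ha, hopp⟩ :=
    h.isWall.linkRays_eq_pair h.isComplete h.mem_left h.mem_right h.ne
  refine ⟨a, ha, fun g hg => ?_⟩
  -- The correction makes `g` vanish at `α` without changing it at `γ` and `γ'`.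
  have := hopp (g - g α • f) (fun u hu => by
    rcases Finset.mem_insert.1 hu with rfl | hu
    · simp [h.map_self]
    · simp [hg u hu, h.vanish u hu])
  simpa [h.map_left, h.map_right] using this

/-- Modulo `Span ω`, `f` is the coordinate along `α` and `g` a positive multiple of the one along
`γ`. A ray in their closed quadrant lies in a cone of the fan and so must be an edge of it. -/
theorem eq_of_map_nonneg (h : IsFlatWall F ω α γ γ' f) {ρ : V} (hρ : ρ ∈ F.linkRays ω)
    (hfρ : 0 ≤ f ρ) {g : V →ₗ[ℝ] ℝ} (hg : ∀ u ∈ insert α ω, g u = 0) (hgγ : 0 < g γ)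
    (hgρ : 0 ≤ g ρ) : ρ = α ∨ ρ = γ := by
  obtain ⟨hγ, hcone⟩ := F.mem_linkRays.1 h.mem_left
  obtain ⟨hρω, hρcone⟩ := F.mem_linkRays.1 hρ
  obtain ⟨c, hc⟩ := mem_span_finset_iff.1 (show ρ ∈ Submodule.span ℝ
    ((insert γ (insert α ω) : Finset V) : Set V) by
      rw [h.isWall.span_insert_eq_top h.mem_left]; trivial)
  have hsum : ∀ k : V →ₗ[ℝ] ℝ, (∀ u ∈ ω, k u = 0) → k ρ = c γ * k γ + c α * k α := by
    intro k hk
    have h0 : ∑ u ∈ ω, k (c u • u) = 0 := Finset.sum_eq_zero fun u hu => by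
      rw [map_smul, hk u hu, smul_zero]
    conv_lhs => rw [hc]
    rw [map_sum, Finset.sum_insert hγ, Finset.sum_insert h.notMem, h0]
    simp
  have h1 := hsum f h.vanish
  have h2 := hsum g fun u hu => hg u (Finset.mem_insert_of_mem hu)
  rw [h.map_left, h.map_self] at h1
  rw [hg α (Finset.mem_insert_self _ _)] at h2
  have hcγ : 0 ≤ c γ := by
    rw [h2, mul_zero, add_zero] at hgρ
    exact nonneg_of_mul_nonneg_left hgρ hgγ
  have hmem := F.mem_of_eq_sum hcone hρcone
    ((Finset.subset_insert _ _).trans (Finset.subset_insert _ _)) (Finset.subset_insert _ _)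
    (Finset.mem_insert_self _ _) (fun u hu huω => by
      rcases Finset.mem_insert.1 hu with rfl | hu
      · exact hcγ
      · rcases Finset.mem_insert.1 hu with rfl | hu
        · linarith
        · exact absurd hu huω) hc
  rcases Finset.mem_insert.1 hmem with h3 | h3
  · exact Or.inr h3
  · exact Or.inl ((Finset.mem_insert.1 h3).resolve_right hρω)

/-- All rays of the link other than `α`, `γ`, `γ'` lie on the negative side. -/
theorem map_neg (h : IsFlatWall F ω α γ γ' f) {ρ : V} (hρ : ρ ∈ F.linkRays ω) (hα : ρ ≠ α)
    (hγ : ρ ≠ γ) (hγ' : ρ ≠ γ') : f ρ < 0 := by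
  by_contra! hfρ
  obtain ⟨hγτ, hcone⟩ := F.mem_linkRays.1 h.mem_left
  obtain ⟨g, hg⟩ := exists_isDualOn (F.linearIndep _ hcone) γ
  have hgτ : ∀ u ∈ insert α ω, g u = 0 := fun u hu => by
    rw [hg u (Finset.mem_insert_of_mem hu), if_neg]
    rintro rfl
    exact hγτ hu
  have hgγ : g γ = 1 := by rw [hg γ (Finset.mem_insert_self _ _), if_pos rfl]
  obtain ⟨a, ha, hopp⟩ := h.exists_opposite
  have hgγ' := hopp g fun u hu => hgτ u (Finset.mem_insert_of_mem hu)
  rcases le_total 0 (g ρ) with h0 | h0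
  · exact (h.eq_of_map_nonneg hρ hfρ hgτ (by rw [hgγ]; norm_num) h0).elim hα hγ
  · exact (h.symm.eq_of_map_nonneg hρ hfρ (g := -g) (fun u hu => by simp [hgτ u hu])
      (by simp [hgγ', hgγ, ha]) (by simpa using h0)).elim hα hγ'

theorem map_nonpos (h : IsFlatWall F ω α γ γ' f) {ρ : V} (hρ : ρ ∈ F.linkRays ω) (hα : ρ ≠ α) :
    f ρ ≤ 0 := by
  by_cases hγ : ρ = γ
  · rw [hγ, h.map_left]
  by_cases hγ' : ρ = γ'
  · rw [hγ', h.map_right]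
  exact (h.map_neg hρ hα hγ hγ').le

variable [DiscreteTopology N] [IsZLattice ℝ N]

theorem mult_ratio_pos (h : IsFlatWall F ω α γ γ' f) {ρ : V} (hρ : ρ ∈ F.linkRays ω) :
    0 < (mult N ω : ℝ) / (mult N (insert ρ ω) : ℝ) :=
  div_pos (mult_pos h.mem_cones) (mult_pos (F.mem_linkRays.1 hρ).2)

/-- If the wall `ω + α` is extremal, the classes of the walls on the negative side are nonnegative
multiples of its class. -/
theorem exists_cls_eq_smul (h : IsFlatWall F ω α γ γ' f) (hext : F.IsExtremalWall (insert α ω))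
    {β : V} (hβ : β ∈ F.linkRays ω) (hfβ : f β < 0) :
    ∃ c : ℝ, 0 ≤ c ∧ F.cls ∅ (insert β ω) = c • F.cls ∅ (insert α ω) := by
  -- The coefficients of `div(χ^f)` on `V(ω)`: only the one at `α` is positive, so solving for that
  -- term leaves a sum of elements of the Mori cone.
  let k : V → ℝ := fun ρ => f ρ * ((mult N ω : ℝ) / (mult N (insert ρ ω) : ℝ))
  have hk : ∀ ρ ∈ F.linkRays ω, ρ ≠ α → 0 ≤ -k ρ := fun ρ hρ hρα => by
    have h1 := h.map_nonpos hρ hρα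
    have h2 := h.mult_ratio_pos hρ
    simp only [k]
    nlinarith
  have hkα : 0 ≤ k α := by
    simpa [k, h.map_self] using (h.mult_ratio_pos h.mem_link).le
  have hkβ : 0 < -k β := by
    have h2 := h.mult_ratio_pos hβ
    simp only [k]
    nlinarith
  have hrel : ∑ ρ ∈ F.linkRays ω, k ρ • F.cls ∅ (insert ρ ω) = 0 :=
    F.sum_linkRays_smul_cls (F.mem_star.2 ⟨h.mem_cones, Finset.empty_subset _⟩) h.vanish
  have hβ' : β ∈ (F.linkRays ω).erase α := Finset.mem_erase.2 ⟨(h.ne_of_map_neg hfβ).1, hβ⟩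
  rw [← Finset.add_sum_erase _ _ h.mem_link, ← Finset.add_sum_erase _ _ hβ'] at hrel
  have hmem : ∀ ρ ∈ F.linkRays ω, ρ ≠ α → -k ρ • F.cls ∅ (insert ρ ω) ∈ F.moriCone :=
    fun ρ hρ hρα => Submodule.smul_mem _ (⟨-k ρ, hk ρ hρ hρα⟩ : {r : ℝ // 0 ≤ r})
      (Submodule.subset_span ⟨_, isWall_insert h.card_add_two hρ, rfl⟩)
  have hx := (hext.2 (-k β • F.cls ∅ (insert β ω)) (hmem β hβ (h.ne_of_map_neg hfβ).1)
    (∑ ρ ∈ ((F.linkRays ω).erase α).erase β, -k ρ • F.cls ∅ (insert ρ ω))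
    (Submodule.sum_mem _ fun ρ hρ => by
      have := Finset.mem_erase.1 (Finset.mem_erase.1 hρ).2
      exact hmem ρ this.2 this.1) (by
    refine Submodule.mem_span_singleton.2 ⟨⟨k α, hkα⟩, ?_⟩
    change k α • F.cls ∅ (insert α ω) = _
    simp only [neg_smul, Finset.sum_neg_distrib]
    rw [← neg_add, eq_neg_iff_add_eq_zero]
    exact hrel)).1
  obtain ⟨⟨c, hc⟩, hcx⟩ := Submodule.mem_span_singleton.1 hx
  change c • F.cls ∅ (insert α ω) = _ at hcx
  refine ⟨(-k β)⁻¹ * c, mul_nonneg (inv_nonneg.2 hkβ.le) hc, ?_⟩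
  rw [mul_smul, hcx, inv_smul_smul₀ hkβ.ne']

/-- If the wall `ω + α` is extremal, each wall on the negative side spans a maximal cone with
`γ`. -/
theorem left_mem_linkRays (h : IsFlatWall F ω α γ γ' f) (hext : F.IsExtremalWall (insert α ω))
    {β : V} (hβ : β ∈ F.linkRays ω) (hfβ : f β < 0) : γ ∈ F.linkRays (insert β ω) := by
  obtain ⟨c, hc, heq⟩ := h.exists_cls_eq_smul hext hβ hfβ
  have hwall := isWall_insert h.card_add_two hβ
  have hint : ∀ ρ, F.intersectionNumber ρ (insert β ω) =
      c * F.intersectionNumber ρ (insert α ω) := fun ρ => by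
    obtain ⟨L, hL⟩ := exists_intersection_linearMap h.isComplete ∅ ρ
    rw [← hL _ hwall (Finset.empty_subset _), heq, map_smul, smul_eq_mul,
      hL _ h.isWall (Finset.empty_subset _)]
  -- If `c` were zero, the curve of `ω + β` would have degree zero against every ray divisor, but it
  -- meets those of its own link positively.
  have hc0 : 0 < c := by
    refine lt_of_le_of_ne hc ?_
    rintro rfl
    obtain ⟨x, y, -, hlink, -⟩ := hwall.exists_linkRays_eq_pair h.isComplete
    have := hwall.intersectionNumber_pos h.isComplete (ρ := x) (by simp [hlink])
    rw [hint, zero_mul] at this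
    exact lt_irrefl _ this
  by_contra hγ
  have h0 := hwall.intersectionNumber_eq_zero h.isComplete (ρ := γ) (by
    rw [Finset.mem_insert, not_or]
    exact ⟨(h.ne_of_map_neg hfβ).2.1.symm, (F.mem_linkRays.1 h.left_mem_link).1⟩) hγ
  rw [hint] at h0
  exact (mul_pos hc0 (h.isWall.intersectionNumber_pos h.isComplete h.mem_left)).ne' h0

/-- Both rays lie in the link of the wall `ω + γ`, which has two elements, one of them `α`. -/
theorem eq_of_map_neg (h : IsFlatWall F ω α γ γ' f) (hext : F.IsExtremalWall (insert α ω))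
    {β β' : V} (hβ : β ∈ F.linkRays ω) (hfβ : f β < 0) (hβ' : β' ∈ F.linkRays ω)
    (hfβ' : f β' < 0) : β' = β := by
  have hwall := isWall_insert h.card_add_two h.left_mem_link
  have h1 := (F.insert_mem_linkRays_comm hβ (h.left_mem_linkRays hext hβ hfβ)).2
  have h2 := (F.insert_mem_linkRays_comm hβ' (h.left_mem_linkRays hext hβ' hfβ')).2
  rw [(hwall.linkRays_eq_pair h.isComplete h.self_mem_link_left h1
    (h.ne_of_map_neg hfβ).1.symm).1] at h2
  simpa [(h.ne_of_map_neg hfβ').1] using h2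

theorem linkRays_eq_of_isExtremalWall (h : IsFlatWall F ω α γ γ' f)
    (hext : F.IsExtremalWall (insert α ω)) {β : V} (hβ : β ∈ F.linkRays ω) (hfβ : f β < 0) :
    F.linkRays ω = {α, γ, β, γ'} := by
  ext x
  simp only [Finset.mem_insert, Finset.mem_singleton]
  constructor
  · intro hx
    by_contra! hne
    exact hne.2.2.1 (h.eq_of_map_neg hext hβ hfβ hx (h.map_neg hx hne.1 hne.2.1 hne.2.2.2))
  · rintro (rfl | rfl | rfl | rfl)
    exacts [h.mem_link, h.left_mem_link, hβ, h.symm.left_mem_link]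

theorem linkIsFourGon (h : IsFlatWall F ω α γ γ' f) (hext : F.IsExtremalWall (insert α ω))
    {β : V} (hβ : β ∈ F.linkRays ω) (hfβ : f β < 0) : F.LinkIsFourGon ω α γ β γ' := by
  have hlink := h.linkRays_eq_of_isExtremalWall hext hβ hfβ
  obtain ⟨h1, h2, h3⟩ := h.ne_of_map_neg hfβ
  refine ⟨hlink, ?_, ?_, ?_, ?_, ?_, ?_, ?_⟩
  · rw [hlink]
    rw [Finset.card_insert_of_notMem (by simp [h.self_ne_left, h.symm.self_ne_left, h1.symm]),
      Finset.card_insert_of_notMem (by simp [h.ne, h2.symm]), Finset.card_pair h3]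
  · exact (F.mem_linkRays.1 h.self_mem_link_left).2
  · exact (F.mem_linkRays.1 (h.left_mem_linkRays hext hβ hfβ)).2
  · rw [Finset.insert_comm]
    exact (F.mem_linkRays.1 (h.symm.left_mem_linkRays hext hβ hfβ)).2
  · exact (F.mem_linkRays.1 h.mem_right).2
  · intro hc
    have : β ∈ F.linkRays (insert α ω) := F.mem_linkRays.2
      ⟨by simp [h1, (F.mem_linkRays.1 hβ).1], by rwa [Finset.insert_comm]⟩
    rw [h.linkRays_eq] at this
    simp [h2, h3] at this
  -- Opposite rays cannot span a cone: the dual of `γ'` would be `1` at `γ'` and `0` at `γ`.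
  · intro hc
    obtain ⟨g, hg⟩ := exists_isDualOn (F.linearIndep _ hc) γ'
    obtain ⟨a, -, hopp⟩ := h.exists_opposite
    have hγ' := (F.mem_linkRays.1 h.symm.left_mem_link).1
    have h4 := hopp g fun u hu => by
      rw [hg u (by simp [hu]), if_neg]
      rintro rfl
      exact hγ' hu
    rw [hg γ (by simp), hg γ' (by simp), if_neg h.ne] at h4
    simp at h4

/-! ### Restricted divisors on the surface of `ω` -/

section Surface

variable {β : V}

/-- A linear relation between restricted divisors on the surface `V(ω)`. -/
theorem map_relation (h : IsFlatWall F ω α γ γ' f)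
    (hext : F.IsExtremalWall (insert α ω)) (hβ : β ∈ F.linkRays ω) (hfβ : f β < 0)
    {m : V →ₗ[ℝ] ℝ} (hm : ∀ u ∈ ω, m u = 0) :
    m α • F.restrict ω α + m γ • F.restrict ω γ + m β • F.restrict ω β +
      m γ' • F.restrict ω γ' = 0 := by
  obtain ⟨h1, h2, h3⟩ := h.ne_of_map_neg hfβ
  have hlink := h.linkRays_eq_of_isExtremalWall hext hβ hfβ
  have hrel := F.sum_linkRays_smul_cls (F.mem_star.2 ⟨h.mem_cones, subset_rfl⟩) hm
  rw [Finset.sum_congr rfl fun ρ hρ => by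
    rw [mul_smul, ← F.restrict_eq_smul_cls h.mem_cones hρ], hlink,
    Finset.sum_insert (by simp [h.self_ne_left, h.symm.self_ne_left, h1.symm]),
    Finset.sum_insert (by simp [h.ne, h2.symm]), Finset.sum_pair h3] at hrel
  rw [← hrel]
  abel

theorem restrict_self_add (h : IsFlatWall F ω α γ γ' f)
    (hext : F.IsExtremalWall (insert α ω)) (hβ : β ∈ F.linkRays ω) (hfβ : f β < 0) :
    F.restrict ω α + f β • F.restrict ω β = 0 := by
  simpa [h.map_self, h.map_left, h.map_right] using h.map_relation hext hβ hfβ h.vanish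

theorem exists_restrict_self_eq (h : IsFlatWall F ω α γ γ' f) :
    ∃ c : ℝ, 0 ≤ c ∧ F.restrict ω α = c • F.cls ω (insert α ω) :=
  ⟨_, (h.mult_ratio_pos h.mem_link).le, F.restrict_eq_smul_cls h.mem_cones h.mem_link⟩

theorem exists_restrict_opposite_eq (h : IsFlatWall F ω α γ γ' f)
    (hext : F.IsExtremalWall (insert α ω)) (hβ : β ∈ F.linkRays ω) (hfβ : f β < 0) :
    ∃ c : ℝ, 0 ≤ c ∧ F.restrict ω β = c • F.cls ω (insert α ω) := by
  obtain ⟨c, hc, hα⟩ := h.exists_restrict_self_eq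
  refine ⟨(-f β)⁻¹ * c, mul_nonneg (inv_nonneg.2 (by linarith)) hc, ?_⟩
  rw [mul_smul, ← hα, eq_neg_of_add_eq_zero_left (h.restrict_self_add hext hβ hfβ), ← neg_smul,
    inv_smul_smul₀ (by linarith)]

theorem exists_linearMap_restrict (h : IsFlatWall F ω α γ γ' f) (ρ : V) :
    ∃ L : F.Chow ω →ₗ[ℝ] ℝ, ∀ x ∈ F.linkRays ω, L (F.restrict ω x) =
      (mult N ω : ℝ) / (mult N (insert x ω) : ℝ) * F.intersectionNumber ρ (insert x ω) := by
  obtain ⟨L, hL⟩ := exists_intersection_linearMap h.isComplete ω ρ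
  refine ⟨L, fun x hx => ?_⟩
  rw [F.restrict_eq_smul_cls h.mem_cones hx, map_smul, smul_eq_mul,
    hL _ (isWall_insert h.card_add_two hx) (Finset.subset_insert _ _)]

/-- There is a linear function on the Chow group of `V(ω)` (intersection with `D_α`) that vanishes
on `D_α` and is positive on `D_γ` and `D_γ'`. -/
theorem exists_linearMap_separating (h : IsFlatWall F ω α γ γ' f) :
    ∃ L : F.Chow ω →ₗ[ℝ] ℝ, L (F.restrict ω α) = 0 ∧ 0 < L (F.restrict ω γ) ∧
      0 < L (F.restrict ω γ') := by
  obtain ⟨L, hL⟩ := h.exists_linearMap_restrict α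
  have hwall := isWall_insert h.card_add_two h.left_mem_link
  have hwall' := isWall_insert h.card_add_two h.symm.left_mem_link
  refine ⟨L, ?_, ?_, ?_⟩
  · rw [hL α h.mem_link, h.isWall.intersectionNumber_eq h.isComplete (f := f) (fun u hu => by
      rcases Finset.mem_insert.1 hu with rfl | huω
      · simp [h.map_self]
      · rw [h.vanish u huω, if_neg]
        rintro rfl
        exact h.notMem huω), h.linkRays_eq, Finset.sum_pair h.ne]
    simp [h.map_left, h.map_right, h.self_ne_left.symm, h.symm.self_ne_left.symm]
  · rw [hL γ h.left_mem_link]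
    exact mul_pos (h.mult_ratio_pos h.left_mem_link)
      (hwall.intersectionNumber_pos h.isComplete h.self_mem_link_left)
  · rw [hL γ' h.symm.left_mem_link]
    exact mul_pos (h.mult_ratio_pos h.symm.left_mem_link)
      (hwall'.intersectionNumber_pos h.isComplete h.symm.self_mem_link_left)

/-- Intersection with `D_γ` is positive on this class. -/
theorem restrict_self_ne_zero (h : IsFlatWall F ω α γ γ' f) : F.restrict ω α ≠ 0 := by
  intro h0
  obtain ⟨L, hL⟩ := h.exists_linearMap_restrict γ
  have := hL α h.mem_link
  rw [h0, map_zero] at this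
  exact (mul_pos (h.mult_ratio_pos h.mem_link)
    (h.isWall.intersectionNumber_pos h.isComplete h.mem_left)).ne this

theorem restrict_self_ne_smul_left (h : IsFlatWall F ω α γ γ' f) :
    ¬ ∃ c : ℝ, F.restrict ω α = c • F.restrict ω γ := by
  rintro ⟨c, hc⟩
  obtain ⟨L, hα, hγ, -⟩ := h.exists_linearMap_separating
  have h1 := congrArg L hc
  rw [hα, map_smul, smul_eq_mul, eq_comm, mul_eq_zero] at h1
  rw [h1.resolve_right hγ.ne', zero_smul] at hc
  exact h.restrict_self_ne_zero hc

/-- The character dual to `γ` on the cone `ω + β + γ` kills `β` and takes the nonzero value `-a` at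
`γ'`, so its relation can be solved for `D_γ'`. -/
theorem exists_restrict_right_eq (h : IsFlatWall F ω α γ γ' f)
    (hext : F.IsExtremalWall (insert α ω)) (hβ : β ∈ F.linkRays ω) (hfβ : f β < 0) :
    ∃ a b : ℝ, F.restrict ω γ' = a • F.restrict ω α + b • F.restrict ω γ := by
  obtain ⟨hγ, hcone⟩ := F.mem_linkRays.1 (h.left_mem_linkRays hext hβ hfβ)
  obtain ⟨g, hg⟩ := exists_isDualOn (F.linearIndep _ hcone) γ
  have hgη : ∀ u ∈ insert β ω, g u = 0 := fun u hu => by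
    rw [hg u (Finset.mem_insert_of_mem hu), if_neg]
    rintro rfl
    exact hγ hu
  have hgω : ∀ u ∈ ω, g u = 0 := fun u hu => hgη u (Finset.mem_insert_of_mem hu)
  have hgγ : g γ = 1 := by rw [hg γ (Finset.mem_insert_self _ _), if_pos rfl]
  obtain ⟨a, ha, hopp⟩ := h.exists_opposite
  have hrel := h.map_relation hext hβ hfβ hgω
  rw [hopp g hgω, hgγ, hgη β (Finset.mem_insert_self _ _), zero_smul, add_zero, one_smul, mul_one,
    neg_smul, ← sub_eq_add_neg, sub_eq_zero] at hrel
  refine ⟨a⁻¹ * g α, a⁻¹, ?_⟩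
  rw [mul_smul, ← smul_add, hrel, inv_smul_smul₀ ha.ne']

theorem coeff_pos_of_restrict_right_eq (h : IsFlatWall F ω α γ γ' f) {a b : ℝ}
    (hab : F.restrict ω γ' = a • F.restrict ω α + b • F.restrict ω γ) : 0 < b := by
  obtain ⟨L, hα, hγ, hγ'⟩ := h.exists_linearMap_separating
  rw [hab, map_add, map_smul, map_smul, hα, smul_zero, zero_add, smul_eq_mul] at hγ'
  exact pos_of_mul_pos_left hγ' hγ.le

end Surface

end IsFlatWall

/-- A wall with `D_α · V(τ) = 0` is flat along `τ \ α`. -/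
theorem isFlatWall_of_intersectionNumber_eq_zero [FiniteDimensional ℝ V] [DiscreteTopology N]
    [IsZLattice ℝ N] (hF : F.IsComplete) {τ : Finset V} (hτ : F.IsWall τ) {γ γ' : V}
    (hγ : γ ∈ F.linkRays τ) (hγ' : γ' ∈ F.linkRays τ) (hne : γ ≠ γ') {α : V} (hα : α ∈ τ)
    (hD : F.intersectionNumber α τ = 0) {f : V →ₗ[ℝ] ℝ}
    (hf : IsDualOn (insert γ τ) α f ∨ IsDualOn (insert γ' τ) α f) :
    IsFlatWall F (τ.erase α) α γ γ' f := by
  have hins : insert α (τ.erase α) = τ := Finset.insert_erase hα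
  have hfτ : IsDualOn τ α f := hf.elim (fun h u hu => h u (Finset.mem_insert_of_mem hu))
    (fun h u hu => h u (Finset.mem_insert_of_mem hu))
  have hγα : γ ≠ α := by rintro rfl; exact (F.mem_linkRays.1 hγ).1 hα
  have hγα' : γ' ≠ α := by rintro rfl; exact (F.mem_linkRays.1 hγ').1 hα
  have hm := mult_pos hτ.1
  have hm1 := mult_pos (F.mem_linkRays.1 hγ).2
  have hm2 := mult_pos (F.mem_linkRays.1 hγ').2
  rw [hτ.intersectionNumber_eq hF hfτ, (hτ.linkRays_eq_pair hF hγ hγ' hne).1,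
    Finset.sum_pair hne, if_neg hγα, if_neg hγα', zero_sub, zero_sub] at hD
  have hD' := (mul_eq_zero.1 hD).resolve_left hm.ne'
  -- One of the two terms vanishes by duality, so degree zero kills the other.
  have hzero : f γ = 0 ∧ f γ' = 0 := by
    rcases hf with h | h
    · have h0 : f γ = 0 := by rw [h γ (Finset.mem_insert_self _ _), if_neg hγα]
      rw [h0, neg_zero, zero_div, zero_add, div_eq_zero_iff, neg_eq_zero] at hD'
      exact ⟨h0, hD'.resolve_right hm2.ne'⟩
    · have h0 : f γ' = 0 := by rw [h γ' (Finset.mem_insert_self _ _), if_neg hγα']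
      rw [h0, neg_zero, zero_div, add_zero, div_eq_zero_iff, neg_eq_zero] at hD'
      exact ⟨hD'.resolve_right hm1.ne', h0⟩
  refine ⟨hF, ?_, F.mem_linkRays.2 ⟨Finset.notMem_erase _ _, hins.symm ▸ hτ.1⟩, hins.symm ▸ hγ,
    hins.symm ▸ hγ', hne, fun u hu => ?_, ?_, hzero.1, hzero.2⟩
  · have h1 := hτ.2
    have h2 := Finset.card_erase_add_one hα
    omega
  · rw [hfτ u (Finset.mem_of_mem_erase hu), if_neg (Finset.ne_of_mem_erase hu)]
  · rw [hfτ α hα, if_pos rfl]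

theorem map_sign_on_relInt_insert {ω : Finset V} {f : V →ₗ[ℝ] ℝ} (hf : ∀ u ∈ ω, f u = 0) (β : V) :
    (0 < f β → ∀ z ∈ relInt (insert β ω), 0 < f z) ∧
    (f β < 0 → ∀ z ∈ relInt (insert β ω), f z < 0) ∧
    (f β = 0 → ∀ z ∈ relInt (insert β ω), f z = 0) := by
  have key : ∀ g : V →ₗ[ℝ] ℝ, (∀ u ∈ ω, g u = 0) → 0 < g β →
      ∀ z ∈ relInt (insert β ω), 0 < g z := fun g hg hgβ z hz =>
    map_pos_of_mem_relInt (fun u hu => by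
      rcases Finset.mem_insert.1 hu with rfl | hu
      exacts [hgβ.le, (hg u hu).ge]) (Finset.mem_insert_self _ _) hgβ hz
  refine ⟨key f hf, fun hβ z hz => ?_, fun hβ z hz => ?_⟩
  · simpa using key (-f) (fun u hu => by simp [hf u hu]) (by simpa using hβ) z hz
  · refine map_eq_zero_of_mem_hull (fun u hu => ?_) (relInt_subset_hull _ hz)
    rcases Finset.mem_insert.1 hu with rfl | hu
    exacts [hβ, hf u hu]

end SimplicialFan

end ToricFan

/-! ### The main theorem -/

open ToricFan in
theorem mainTheorem12 {V : Type*} [NormedAddCommGroup V] [NormedSpace ℝ V] [FiniteDimensional ℝ V]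
    (N : Submodule ℤ V) [DiscreteTopology N] [IsZLattice ℝ N]
    (F : SimplicialFan N) (hF : F.IsComplete)
    (τ : Finset V) (hτ : F.IsWall τ)
    -- the two maximal cones `σ = τ + γ` and `σ' = τ + γ'` containing the wall `τ`
    (γ γ' : V) (hγτ : γ ∉ τ) (hγτ' : γ' ∉ τ) (hγγ' : γ ≠ γ')
    (hσ : insert γ τ ∈ F.cones) (hσ' : insert γ' τ ∈ F.cones)
    (α : V) (hα : α ∈ τ) (hD : F.intersectionNumber α τ = 0)
    -- `αs` is dual to `α` with respect to the basis of the rays of `σ` or of `σ'`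
    (αs : V →ₗ[ℝ] ℝ)
    (hαs : IsDualOn (insert γ τ) α αs ∨ IsDualOn (insert γ' τ) α αs) :
    -- Part 1
    (∀ η, F.IsWall η → τ.erase α ⊆ η →
      (∀ z ∈ relInt η, 0 < αs z) ∨ (∀ z ∈ relInt η, αs z < 0) ∨ (∀ z ∈ relInt η, αs z = 0)) ∧
    -- Part 2
    (∃ η, F.IsWall η ∧ τ.erase α ⊆ η ∧
      η ≠ τ ∧ η ≠ insert γ (τ.erase α) ∧ η ≠ insert γ' (τ.erase α)) ∧
    (∀ η, F.IsWall η → τ.erase α ⊆ η →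
      η ≠ τ → η ≠ insert γ (τ.erase α) → η ≠ insert γ' (τ.erase α) →
      (∀ z ∈ relInt η, αs z < 0) ∧
      (F.IsExtremalWall τ → ∃ c : ℝ, 0 ≤ c ∧ F.cls ∅ η = c • F.cls ∅ τ) ∧
      -- Part 3
      (F.IsExtremalWall τ → F.IsFlag →
        -- `η` is adjacent to `γ` and `γ'` and is the only wall on the negative side
        (γ ∉ η ∧ insert γ η ∈ F.cones) ∧ (γ' ∉ η ∧ insert γ' η ∈ F.cones) ∧
        (∀ η', F.IsWall η' → τ.erase α ⊆ η' → (∀ z ∈ relInt η', αs z < 0) → η' = η) ∧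
        ∃ β, β ∉ τ.erase α ∧ η = insert β (τ.erase α) ∧
          F.LinkIsFourGon (τ.erase α) α γ β γ' ∧
          (∃ c : ℝ, 0 ≤ c ∧ F.restrict (τ.erase α) β = c • F.cls (τ.erase α) τ) ∧
          (∃ c : ℝ, 0 ≤ c ∧ F.restrict (τ.erase α) α = c • F.cls (τ.erase α) τ) ∧
          (¬ ∃ c : ℝ, F.restrict (τ.erase α) α = c • F.restrict (τ.erase α) γ) ∧
          (¬ ∃ c : ℝ, F.restrict (τ.erase α) α = c • F.restrict (τ.erase α) γ') ∧
          (∃ a b : ℝ, F.restrict (τ.erase α) γ' =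
            a • F.restrict (τ.erase α) α + b • F.restrict (τ.erase α) γ) ∧
          (∀ a b : ℝ, F.restrict (τ.erase α) γ' =
            a • F.restrict (τ.erase α) α + b • F.restrict (τ.erase α) γ → 0 < b))) := by
  have hγ := F.mem_linkRays.2 ⟨hγτ, hσ⟩
  have hγ' := F.mem_linkRays.2 ⟨hγτ', hσ'⟩
  have h := SimplicialFan.isFlatWall_of_intersectionNumber_eq_zero hF hτ hγ hγ' hγγ' hα hD hαs
  have hins : insert α (τ.erase α) = τ := Finset.insert_erase hα
  -- From here `ω` is the basic object and `τ` becomes `insert α ω`.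
  generalize τ.erase α = ω at h hins ⊢
  subst hins
  have hsign := fun β => SimplicialFan.map_sign_on_relInt_insert h.vanish β
  refine ⟨fun η hη hωη => ?_, ?_, fun η hη hωη hne hneγ hneγ' => ?_⟩
  · obtain ⟨β, -, rfl⟩ := hη.exists_eq_insert h.card_add_two hωη
    rcases lt_trichotomy (αs β) 0 with h0 | h0 | h0
    · exact Or.inr (Or.inl ((hsign β).2.1 h0))
    · exact Or.inr (Or.inr ((hsign β).2.2 h0))
    · exact Or.inl ((hsign β).1 h0)
  · obtain ⟨β, hβ, hneg⟩ := F.exists_mem_linkRays_pos hF h.mem_cones (f := -αs) (v := -α)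
      (fun u hu => by simp [h.vanish u hu]) (by simp [h.map_self])
    have hβω := (F.mem_linkRays.1 hβ).1
    obtain ⟨h1, h2, h3⟩ := h.ne_of_map_neg (β := β) (by simpa using hneg)
    have hne : ∀ x, β ≠ x → insert β ω ≠ insert x ω := fun x hx heq =>
      (Finset.mem_insert.1 (heq ▸ Finset.mem_insert_self β ω)).elim hx hβω
    exact ⟨insert β ω, SimplicialFan.isWall_insert h.card_add_two hβ, Finset.subset_insert _ _,
      hne _ h1, hne _ h2, hne _ h3⟩
  · obtain ⟨β, hβ, rfl⟩ := hη.exists_eq_insert h.card_add_two hωη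
    have hfβ : αs β < 0 := h.map_neg hβ (by rintro rfl; exact hne rfl)
      (by rintro rfl; exact hneγ rfl) (by rintro rfl; exact hneγ' rfl)
    refine ⟨(hsign β).2.1 hfβ, fun hext => h.exists_cls_eq_smul hext hβ hfβ, fun hext _ => ?_⟩
    refine ⟨F.mem_linkRays.1 (h.left_mem_linkRays hext hβ hfβ),
      F.mem_linkRays.1 (h.symm.left_mem_linkRays hext hβ hfβ), fun η' hη' hωη' hneg => ?_,
      β, (F.mem_linkRays.1 hβ).1, rfl, h.linkIsFourGon hext hβ hfβ,
      h.exists_restrict_opposite_eq hext hβ hfβ, h.exists_restrict_self_eq,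
      h.restrict_self_ne_smul_left, h.symm.restrict_self_ne_smul_left,
      h.exists_restrict_right_eq hext hβ hfβ, fun a b hab => h.coeff_pos_of_restrict_right_eq hab⟩
    obtain ⟨β', hβ', rfl⟩ := hη'.exists_eq_insert h.card_add_two hωη'
    -- Nonemptiness lets the sign on the relative interior determine the sign of `αs β'`.
    obtain ⟨z, hz⟩ := relInt_nonempty (insert β' ω)
    have hzneg := hneg z hz
    rcases lt_trichotomy (αs β') 0 with h0 | h0 | h0
    · rw [h.eq_of_map_neg hext hβ hfβ hβ' h0]
    · exact absurd ((hsign β').2.2 h0 z hz) hzneg.ne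
    · exact absurd ((hsign β').1 h0 z hz) hzneg.not_gt
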